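/- Conventions. Let $\Omega\subset\mathbb C^n$ be a domain (nonempty, open, connected). $\mathcal{PSH}(\Omega)$ is the set of plurisubharmonic functions $\varphi\colon\Omega\to[-\infty,\infty)$; $\mathcal{PSH}^*(\Omega)=\mathcal{PSH}(\Omega)\cap L^\infty_{loc}(\Omega)$ is the set of locally bounded ones, and $\mathcal{PSH}^0(\Omega)=\mathcal{PSH}(\Omega)\cap\mathcal C^0(\Omega)$ the set of real-valued continuous ones. A function $\varphi\colon U\to[-\infty,\infty)$, $\varphi\not\equiv-\infty$, on an open set $U\subset\mathbb C^n$ is called strictly plurisubharmonic if for every $\mathcal C^\infty$-smooth $\theta\colon U\to\mathbb R$ with compact support in $U$ there is $\varepsilon_0>0$ such that $\varphi+\varepsilon\theta$ is plurisubharmonic on $U$ for all $\varepsilon\in(-\varepsilon_0,\varepsilon_0)$; it is strictly plurisubharmonic near a point $z$ if it is strictly plurisubharmonic on some open neighbourhood of $z$. Let $\mathfrak c^*(\Omega)$ (respectively $\mathfrak c^0(\Omega)$) be the set of all $z\in\Omega$ such that every function $\varphi$ in $\mathcal{PSH}^*(\Omega)$ (respectively $\mathcal{PSH}^0(\Omega)$)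 that is bounded from above on $\Omega$ fails to be strictly plurisubharmonic near $z$. A domain is pseudoconvex if it admits a continuous plurisubharmonic exhaustion function. Theorem 1. For every integer $n\ge 2$ there exist a pseudoconvex domain $\Omega\subset\mathbb C^n$ and a nonempty open set $\omega\subset\Omega$ such that: (1) there exists a function $\varphi\in\mathcal{PSH}(\Omega)\cap L^\infty_{loc}(\Omega)$ such that $\varphi<0$ on $\Omega$ and $\varphi$ is strictly plurisubharmonic on $\omega$; (2) every function $\varphi\in\mathcal{PSH}(\Omega)\cap\mathcal C^0(\Omega)$ such that $\varphi<0$ on $\Omega$ is constant on $\omega$. In particular, for this $\Omega$, $\mathfrak c^*(\Omega)\ne\mathfrak c^0(\Omega)$. -/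

import Mathlib

open Set Filter Topology MeasureTheory
open scoped ENNReal

namespace PSHCore

noncomputable section

/-- The mean value over the unit circle of a function `g : ℂ → [-∞, ∞]`, as the mean of the positive
part minus the mean of the negative part. It is the usual integral mean, with value `-∞` allowed,
whenever `g` is measurable and bounded above on the circle. -/
def circleMean (g : ℂ → EReal) : EReal :=
  (((∫⁻ t in Ioc 0 (2 * Real.pi), (g (circleMap 0 1 t)).toENNReal) /
      ENNReal.ofReal (2 * Real.pi) : ℝ≥0∞) : EReal) -
    (((∫⁻ t in Ioc 0 (2 * Real.pi), (-g (circleMap 0 1 t)).toENNReal) /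
      ENNReal.ofReal (2 * Real.pi) : ℝ≥0∞) : EReal)

/-- `f` is plurisubharmonic on the open set `U ⊆ ℂⁿ` (only the values of `f` on `U` matter):
it takes values in `[-∞, ∞)`, is upper semicontinuous, and satisfies the sub-mean value inequality
on every closed disc `{z + ζ ξ : |ζ| ≤ 1}` contained in `U`. -/
structure IsPSHOn {n : ℕ} (f : EuclideanSpace ℂ (Fin n) → EReal)
    (U : Set (EuclideanSpace ℂ (Fin n))) : Prop where
  lt_top : ∀ z ∈ U, f z < ⊤
  usc : UpperSemicontinuousOn f U
  le_circleMean : ∀ z ξ : EuclideanSpace ℂ (Fin n), (∀ ζ : ℂ, ‖ζ‖ ≤ 1 → z + ζ • ξ ∈ U) →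
    f z ≤ circleMean (fun ζ => f (z + ζ • ξ))

/-- Strict plurisubharmonicity on the open set `U`: `f` is not identically `-∞` on `U`, and for every
real smooth `θ` with compact support in `U`, all sufficiently small real multiples of `θ` can be
added to `f` without destroying plurisubharmonicity. -/
def IsStrictPSHOn {n : ℕ} (f : EuclideanSpace ℂ (Fin n) → EReal)
    (U : Set (EuclideanSpace ℂ (Fin n))) : Prop :=
  (∀ z ∈ U, f z < ⊤) ∧ (∃ z ∈ U, f z ≠ ⊥) ∧
    ∀ θ : EuclideanSpace ℂ (Fin n) → ℝ, ContDiff ℝ ((⊤ : ℕ∞) : WithTop ℕ∞) θ → HasCompactSupport θ → tsupport θ ⊆ U →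
      ∃ ε₀ : ℝ, 0 < ε₀ ∧ ∀ ε ∈ Ioo (-ε₀) ε₀,
        IsPSHOn (fun z => f z + ((ε * θ z : ℝ) : EReal)) U

/-- `f` is strictly plurisubharmonic near the point `z` of the open set `Ω`. -/
def IsStrictPSHNear {n : ℕ} (f : EuclideanSpace ℂ (Fin n) → EReal)
    (Ω : Set (EuclideanSpace ℂ (Fin n))) (z : EuclideanSpace ℂ (Fin n)) : Prop :=
  ∃ U : Set (EuclideanSpace ℂ (Fin n)), IsOpen U ∧ z ∈ U ∧ U ⊆ Ω ∧ IsStrictPSHOn f U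

/-- `PSH*(Ω)`: the locally bounded plurisubharmonic functions on `Ω`. -/
def PSHLocBdd {n : ℕ} (Ω : Set (EuclideanSpace ℂ (Fin n))) :
    Set (EuclideanSpace ℂ (Fin n) → EReal) :=
  {f | IsPSHOn f Ω ∧ ∀ z ∈ Ω, ∃ V ∈ 𝓝 z, ∃ M : ℝ, ∀ w ∈ V ∩ Ω,
    ((-M : ℝ) : EReal) ≤ f w ∧ f w ≤ (M : EReal)}

/-- `PSH⁰(Ω)`: the plurisubharmonic functions on `Ω` that are real-valued and continuous. -/
def PSHCont {n : ℕ} (Ω : Set (EuclideanSpace ℂ (Fin n))) :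
    Set (EuclideanSpace ℂ (Fin n) → EReal) :=
  {f | IsPSHOn f Ω ∧ ∃ g : EuclideanSpace ℂ (Fin n) → ℝ,
    ContinuousOn g Ω ∧ ∀ z ∈ Ω, f z = (g z : EReal)}

/-- The core of `Ω` with respect to a class `F` of functions on `Ω`: the points of `Ω` near which
every member of `F` that is bounded from above on `Ω` fails to be strictly plurisubharmonic. -/
def core {n : ℕ} (F : Set (EuclideanSpace ℂ (Fin n) → EReal))
    (Ω : Set (EuclideanSpace ℂ (Fin n))) : Set (EuclideanSpace ℂ (Fin n)) :=
  {z | z ∈ Ω ∧ ∀ f ∈ F, (∃ M : ℝ, ∀ w ∈ Ω, f w ≤ (M : EReal)) → ¬ IsStrictPSHNear f Ω z}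

/-- The core `𝔠*(Ω)` with respect to locally bounded plurisubharmonic functions. -/
def coreLocBdd {n : ℕ} (Ω : Set (EuclideanSpace ℂ (Fin n))) : Set (EuclideanSpace ℂ (Fin n)) :=
  core (PSHLocBdd Ω) Ω

/-- The core `𝔠⁰(Ω)` with respect to continuous plurisubharmonic functions. -/
def coreCont {n : ℕ} (Ω : Set (EuclideanSpace ℂ (Fin n))) : Set (EuclideanSpace ℂ (Fin n)) :=
  core (PSHCont Ω) Ω

/-- A pseudoconvex domain in `ℂⁿ`: a nonempty connected open set that has a continuous
plurisubharmonic exhaustion function. -/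
structure IsPseudoconvexDomain {n : ℕ} (Ω : Set (EuclideanSpace ℂ (Fin n))) : Prop where
  isOpen : IsOpen Ω
  isConnected : IsConnected Ω
  exists_exhaustion : ∃ u : EuclideanSpace ℂ (Fin n) → ℝ, ContinuousOn u Ω ∧
    IsPSHOn (fun z => (u z : EReal)) Ω ∧ ∀ c : ℝ, IsCompact {z | z ∈ Ω ∧ u z ≤ c}

end

end PSHCore

/-!
# A domain whose continuous and locally bounded cores differ

Choose vectors `aₖ` that are dense in the shell `1/10 < ‖b‖ < 1` and weight the hyperplanes
`Hₖ = {⟨aₖ, x⟩ = 1}`, none of which meets the closed unit ball, by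

  `u x = ∑ₖ 2⁻ᵏ⁻¹ log |1 - ⟨aₖ, x⟩| + ‖x‖² - 201`.

The domain `Ω` is the component of the origin in `{u < 0}`. It contains the ball of radius `10`
and all the hyperplanes `Hₖ`, on which `u = -∞`. The open set `ω` is the ball of radius `1/2`.

*Locally bounded functions.* `max u (-202)` is bounded, plurisubharmonic and negative on `Ω`. On
`ω` it equals `u`, which is the sum of a plurisubharmonic function and `‖x‖²`, so it is strictly
plurisubharmonic there. The function `u` is the limit of the decreasing sequence `potential a N` of
continuous functions, in which the logarithms are truncated at `-N` and the sum is cut off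
(`limitPotential_mem`, `isStrictPSHOn_limitPotential`).

*Continuous functions.* A continuous negative plurisubharmonic function on `Ω` is constant on each
complex line contained in `Ω`, by Liouville's theorem, hence on each `Hₖ`. The hyperplanes meet
each other (this is where `n ≥ 2` is used), so the constant is the same for all `k`
(`exists_eq_on_hyperplanes`). They are dense in the part of the ball of radius `10` outside of the
closed unit ball, so by continuity the function is constant there, and the maximum principle on
complex discs extends the constancy to the ball `ω` (`eq_const_on_ball`). An upper semicontinuous
function may jump upwards off the hyperplanes, so the density argument fails for it.

*Pseudoconvexity.* The exhaustion is `‖x‖² - log dist (x, Ωᶜ)`. Since `u` satisfies the maximum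
principle on holomorphic discs (`discConvex_sublevel`), the Hartogs argument with moving discs shows
that `- log dist (x, Ωᶜ)` is plurisubharmonic (`DiscConvex.submeanOn_neg_log_infDist`). The passage
from majorants to mean values rests on the density of trigonometric polynomials
(`le_circleAverage_of_majorants`).
-/

namespace PSHCore

/-! ### Subharmonic functions of one complex variable -/

/-- `f` satisfies the sub-mean value inequality on all sufficiently small circles around `c`. -/
def LocSubmean (f : ℂ → ℝ) (c : ℂ) : Prop :=
  ∀ᶠ r : ℝ in 𝓝[>] 0, f c ≤ Real.circleAverage f c r

/-- Equality in the sub-mean value inequality at a maximum forces constancy on the circle. -/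
lemma eq_of_le_circleAverage {f : ℂ → ℝ} {c : ℂ} {r M : ℝ} (hr : 0 ≤ r)
    (hf : ContinuousOn f (Metric.sphere c r)) (hle : ∀ z ∈ Metric.sphere c r, f z ≤ M)
    (hM : M ≤ Real.circleAverage f c r) : ∀ z ∈ Metric.sphere c r, f z = M := by
  by_contra! hcon
  obtain ⟨z, hz, hne⟩ := hcon
  have hlt : f z < M := lt_of_le_of_ne (hle z hz) hne
  obtain ⟨t, ht, rfl⟩ : ∃ t ∈ Ioc 0 (2 * Real.pi), circleMap c r t = z := by
    have h := image_circleMap_Ioc c r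
    rw [abs_of_nonneg hr] at h
    have := h.symm ▸ hz
    exact this
  have hcont : Continuous fun t => f (circleMap c r t) := by
    refine hf.comp_continuous (continuous_circleMap c r) fun t => ?_
    exact circleMap_mem_sphere c hr t
  have hpos : 0 < ∫ t in (0 : ℝ)..(2 * Real.pi), (M - f (circleMap c r t)) := by
    refine intervalIntegral.integral_pos Real.two_pi_pos
      (continuous_const.sub hcont).continuousOn
      (fun t _ => sub_nonneg.2 (hle _ (circleMap_mem_sphere c hr t)))
      ⟨t, ⟨ht.1.le, ht.2⟩, sub_pos.2 hlt⟩
  rw [intervalIntegral.integral_sub (by simp) (hcont.intervalIntegrable _ _)] at hpos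
  rw [Real.circleAverage_def, smul_eq_mul] at hM
  have h2 := Real.two_pi_pos
  rw [le_inv_mul_iff₀ h2] at hM
  simp at hpos
  linarith

/-- The maximum principle. -/
lemma LocSubmean.le_of_isCompact {f : ℂ → ℝ} {K : Set ℂ} {B : ℝ} (hK : IsCompact K)
    (hf : ContinuousOn f K) (hloc : ∀ c ∈ interior K, LocSubmean f c)
    (hB : ∀ z ∈ K, z ∉ interior K → f z ≤ B) : ∀ z ∈ K, f z ≤ B := by
  intro z hz
  obtain ⟨x, hx, hmax⟩ := hK.exists_isMaxOn ⟨z, hz⟩ hf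
  refine (hmax hz).trans ?_
  have hcl : IsCompact (K ∩ f ⁻¹' {f x}) :=
    hK.of_isClosed_subset (hf.preimage_isClosed_of_isClosed hK.isClosed isClosed_singleton)
      inter_subset_left
  -- among the maximum points, take one with the largest real part
  obtain ⟨y, hy, hymax⟩ := hcl.exists_isMaxOn ⟨x, hx, rfl⟩ Complex.continuous_re.continuousOn
  have hyx : f y = f x := hy.2
  by_cases hyi : y ∈ interior K
  · exfalso
    obtain ⟨ρ, hρ, hball⟩ := Metric.mem_nhds_iff.1 (mem_interior_iff_mem_nhds.1 hyi)
    have hev : ∀ᶠ r : ℝ in 𝓝[>] 0, r ∈ Ioo 0 ρ := Ioo_mem_nhdsGT hρ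
    obtain ⟨r, hr, hr0, hrρ⟩ := ((hloc y hyi).and hev).exists
    have hsub : Metric.sphere y r ⊆ K :=
      (Metric.sphere_subset_closedBall.trans (Metric.closedBall_subset_ball hrρ)).trans hball
    have hmem : y + r ∈ Metric.sphere y r := by simp [abs_of_pos hr0]
    have := eq_of_le_circleAverage hr0.le (hf.mono hsub)
      (fun w hw => (hmax (hsub hw)).trans hyx.ge) hr _ hmem
    have h2 := hymax ⟨hsub hmem, (this.trans hyx : f (y + r) = f x)⟩
    simp at h2
    linarith
  · exact hyx ▸ hB y hy.1 hyi

lemma eventually_sphere_subset {U : Set ℂ} {c : ℂ} (hU : U ∈ 𝓝 c) :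
    ∀ᶠ r : ℝ in 𝓝[>] 0, 0 < r ∧ Metric.closedBall c r ⊆ U := by
  obtain ⟨ρ, hρ, hball⟩ := Metric.mem_nhds_iff.1 hU
  filter_upwards [Ioo_mem_nhdsGT hρ] with r hr
  exact ⟨hr.1, (Metric.closedBall_subset_ball hr.2).trans hball⟩

lemma LocSubmean.add {f g : ℂ → ℝ} {c : ℂ} {U : Set ℂ} (hU : U ∈ 𝓝 c) (hf : ContinuousOn f U)
    (hg : ContinuousOn g U) (h1 : LocSubmean f c) (h2 : LocSubmean g c) :
    LocSubmean (fun z => f z + g z) c := by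
  filter_upwards [h1, h2, eventually_sphere_subset hU] with r h1 h2 ⟨hr, hs⟩
  have hs' := Metric.sphere_subset_closedBall.trans hs
  rw [Real.circleAverage_fun_add ((hf.mono hs').circleIntegrable hr.le)
    ((hg.mono hs').circleIntegrable hr.le)]
  exact add_le_add h1 h2

lemma LocSubmean.const_mul {f : ℂ → ℝ} {c : ℂ} {a : ℝ} (ha : 0 ≤ a) (h : LocSubmean f c) :
    LocSubmean (fun z => a * f z) c := by
  filter_upwards [h] with r h
  have := Real.circleAverage_fun_smul (f := f) (c := c) (R := r) (a := a)
  simp only [smul_eq_mul] at this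
  rw [this]
  exact mul_le_mul_of_nonneg_left h ha

lemma locSubmean_const (a : ℝ) (c : ℂ) : LocSubmean (fun _ => a) c :=
  Eventually.of_forall fun r => by rw [Real.circleAverage_const]

/-- A function attaining its minimum at `c` satisfies the local sub-mean value inequality at `c`. -/
lemma locSubmean_of_min {f : ℂ → ℝ} {c : ℂ} {U : Set ℂ} (hU : U ∈ 𝓝 c) (hf : ContinuousOn f U)
    (hmin : ∀ z, f c ≤ f z) : LocSubmean f c := by
  filter_upwards [eventually_sphere_subset hU] with r ⟨hr, hs⟩
  have hs' := Metric.sphere_subset_closedBall.trans hs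
  rw [← Real.circleAverage_const (f c) c r]
  exact Real.circleAverage_mono (circleIntegrable_const _ _ _)
    ((hf.mono hs').circleIntegrable hr.le) fun z _ => hmin z

lemma locSubmean_max {f g : ℂ → ℝ} {c : ℂ} {U : Set ℂ} (hU : U ∈ 𝓝 c) (hf : ContinuousOn f U)
    (hg : ContinuousOn g U) (h1 : LocSubmean f c) (h2 : LocSubmean g c) :
    LocSubmean (fun z => max (f z) (g z)) c := by
  filter_upwards [h1, h2, eventually_sphere_subset hU] with r h1 h2 ⟨hr, hs⟩
  have hs' := Metric.sphere_subset_closedBall.trans hs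
  have i1 := (hf.mono hs').circleIntegrable hr.le
  have i2 := (hg.mono hs').circleIntegrable hr.le
  have i3 := ((hf.sup hg).mono hs').circleIntegrable hr.le
  exact max_le (h1.trans (Real.circleAverage_mono i1 i3 fun z _ => le_max_left _ _))
    (h2.trans (Real.circleAverage_mono i2 i3 fun z _ => le_max_right _ _))

lemma locSubmean_of_harmonic {h : ℂ → ℝ} {c : ℂ}
    (hh : ∀ᶠ z in 𝓝 c, InnerProductSpace.HarmonicAt h z) : LocSubmean h c := by
  filter_upwards [eventually_sphere_subset hh] with r ⟨hr, hs⟩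
  rw [InnerProductSpace.HarmonicOnNhd.circleAverage_eq]
  rw [abs_of_pos hr]
  exact fun z hz => hs hz

lemma locSubmean_re {p : ℂ → ℂ} (hp : Differentiable ℂ p) (c : ℂ) :
    LocSubmean (fun z => (p z).re) c :=
  locSubmean_of_harmonic <| Eventually.of_forall fun z => (hp.analyticAt z).harmonicAt_re

/-- The truncation from below at `-T` of `log ‖c‖`; truncating avoids the value `-∞`. -/
noncomputable def truncLog (T : ℝ) (c : ℂ) : ℝ := Real.log (max ‖c‖ (Real.exp (-T)))

lemma continuous_truncLog (T : ℝ) : Continuous (truncLog T) := by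
  unfold truncLog
  exact (continuous_norm.max continuous_const).log fun x =>
    (lt_max_of_lt_right (Real.exp_pos _)).ne'

lemma neg_le_truncLog (T : ℝ) (c : ℂ) : -T ≤ truncLog T c := by
  unfold truncLog
  rw [Real.le_log_iff_exp_le (lt_max_of_lt_right (Real.exp_pos _))]
  exact le_max_right _ _

lemma truncLog_antitone (c : ℂ) : Antitone fun T => truncLog T c := by
  intro S T h
  unfold truncLog
  refine Real.log_le_log (lt_max_of_lt_right (Real.exp_pos _)) ?_
  gcongr

lemma locSubmean_truncLog {h : ℂ → ℂ} (hh : Differentiable ℂ h) (T : ℝ) (c : ℂ) :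
    LocSubmean (fun z => truncLog T (h z)) c := by
  by_cases hc : ‖h c‖ ≤ Real.exp (-T)
  · refine locSubmean_of_min univ_mem
      ((continuous_truncLog T).comp hh.continuous).continuousOn fun z => ?_
    refine le_trans (le_of_eq ?_) (neg_le_truncLog T (h z))
    simp [truncLog, max_eq_right hc]
  · push Not at hc
    refine locSubmean_of_harmonic ?_
    have hev : ∀ᶠ z in 𝓝 c, Real.exp (-T) < ‖h z‖ :=
      (hh.continuous.norm.continuousAt).eventually (lt_mem_nhds hc)
    filter_upwards [hev.eventually_nhds] with z hz
    have h0 : h z ≠ 0 := by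
      have := (Real.exp_pos (-T)).trans hz.self_of_nhds
      simpa using this
    refine (InnerProductSpace.harmonicAt_congr_nhds ?_).1
      ((hh.analyticAt z).harmonicAt_log_norm h0)
    filter_upwards [hz] with w hw
    simp [truncLog, max_eq_left hw.le]

lemma normSq_le_circleAverage {E : Type*} [NormedAddCommGroup E] [InnerProductSpace ℂ E]
    {F : ℂ → E} (hF : Differentiable ℂ F) (c : ℂ) (r : ℝ) :
    ‖F c‖ ^ 2 ≤ Real.circleAverage (fun z => ‖F z‖ ^ 2) c r := by
  have hp : Differentiable ℂ fun z => 2 * inner ℂ (F c) (F z) :=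
    (((innerSL ℂ (F c)).differentiable.comp hF)).const_mul 2
  have h1 : Real.circleAverage (fun z => (2 * inner ℂ (F c) (F z)).re - ‖F c‖ ^ 2) c r
      = ‖F c‖ ^ 2 := by
    rw [InnerProductSpace.HarmonicOnNhd.circleAverage_eq]
    · have := inner_self_eq_norm_sq (𝕜 := ℂ) (F c)
      simp only [RCLike.re_to_complex] at this
      simp only [Complex.mul_re, Complex.re_ofNat, Complex.im_ofNat, zero_mul, sub_zero, this]
      ring
    · intro z _
      have h1 := (hp.analyticAt z).harmonicAt_re
      have h2 : InnerProductSpace.HarmonicAt (fun _ : ℂ => -‖F c‖ ^ 2) z := by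
        have := (analyticAt_const (𝕜 := ℂ) (v := ((-‖F c‖ ^ 2 : ℝ) : ℂ)) (x := z)).harmonicAt_re
        convert this using 2
        simp
        norm_cast
      exact h1.add h2
  have c1 : Continuous fun z => (2 * inner ℂ (F c) (F z)).re - ‖F c‖ ^ 2 :=
    (Complex.continuous_re.comp hp.continuous).sub continuous_const
  have c2 : Continuous fun z => ‖F z‖ ^ 2 := hF.continuous.norm.pow 2
  refine h1.ge.trans <| Real.circleAverage_mono c1.continuousOn.circleIntegrable'
    c2.continuousOn.circleIntegrable' fun z _ => ?_
  have h3 : 0 ≤ ‖F z - F c‖ ^ 2 := sq_nonneg _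
  rw [@norm_sub_sq ℂ, ← inner_conj_symm, RCLike.conj_re] at h3
  simp at h3 ⊢
  linarith

/-- A continuous function on the unit circle is bounded by its mean at `0`, provided it is bounded
there by every harmonic polynomial that majorises it on the circle: trigonometric polynomials are
dense, and they are the boundary values of harmonic polynomials. -/
lemma le_circleAverage_of_majorants {f : ℂ → ℝ} (hf : ContinuousOn f (Metric.sphere 0 1))
    (H : ∀ p : ℂ → ℂ, Differentiable ℂ p → (∀ z ∈ Metric.sphere (0 : ℂ) 1, f z < (p z).re) →
      f 0 ≤ (p 0).re) : f 0 ≤ Real.circleAverage f 0 1 := by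
  have key : ∀ q ∈ Submodule.span ℂ (range (@fourier 1)), ∀ a : ℂ, ∃ p : ℂ → ℂ,
      Differentiable ℂ p ∧
        ∀ x : AddCircle (1 : ℝ), (p (AddCircle.toCircle x)).re = (a * q x).re := by
    intro q hq
    induction hq using Submodule.span_induction with
    | mem x hx =>
      obtain ⟨m, rfl⟩ := hx
      intro a
      rcases le_total 0 m with hm | hm
      · lift m to ℕ using hm
        refine ⟨fun z => a * z ^ m, by fun_prop, fun x => ?_⟩
        simp [fourier_apply, AddCircle.toCircle_nsmul]
      · obtain ⟨k, rfl⟩ : ∃ k : ℕ, m = -(k : ℤ) := ⟨m.natAbs, by omega⟩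
        refine ⟨fun z => (starRingEnd ℂ) a * z ^ k, by fun_prop, fun x => ?_⟩
        have : (a * fourier (-(k : ℤ)) x) =
            (starRingEnd ℂ) ((starRingEnd ℂ) a * fourier (k : ℤ) x) := by
          rw [fourier_neg]; simp
        rw [this, Complex.conj_re]
        simp [fourier_apply, AddCircle.toCircle_nsmul]
    | zero => exact fun a => ⟨fun _ => 0, by fun_prop, by simp⟩
    | add x y _ _ hx hy =>
      intro a
      obtain ⟨p, hp, hp'⟩ := hx a
      obtain ⟨q, hq, hq'⟩ := hy a
      refine ⟨fun z => p z + q z, by fun_prop, fun t => ?_⟩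
      simp only [Complex.add_re, hp', hq', ContinuousMap.add_apply, mul_add]
    | smul b x _ hx =>
      intro a
      obtain ⟨p, hp, hp'⟩ := hx (a * b)
      refine ⟨p, hp, fun t => ?_⟩
      rw [hp', ContinuousMap.smul_apply, smul_eq_mul, mul_assoc]
  have hmem : ∀ x : AddCircle (1 : ℝ), (AddCircle.toCircle x : ℂ) ∈ Metric.sphere (0 : ℂ) 1 :=
    fun x => by rw [mem_sphere_zero_iff_norm]; exact Circle.norm_coe _
  let g : C(AddCircle (1 : ℝ), ℂ) :=
    ⟨fun x => (f (AddCircle.toCircle x) : ℂ), Complex.continuous_ofReal.comp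
      (hf.comp_continuous (continuous_subtype_val.comp AddCircle.continuous_toCircle) hmem)⟩
  refine le_of_forall_pos_le_add fun ε hε => ?_
  have hg : g ∈ (Submodule.span ℂ (range (@fourier 1))).topologicalClosure := by
    have : Fact ((0 : ℝ) < 1) := ⟨one_pos⟩
    rw [span_fourier_closure_eq_top]; trivial
  obtain ⟨q, hq, hqg⟩ := Metric.mem_closure_iff.1 hg (ε / 2) (by positivity)
  obtain ⟨p, hp, hpq⟩ := key q hq 1
  have hclose : ∀ z ∈ Metric.sphere (0 : ℂ) 1, |f z - (p z).re| < ε / 2 := by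
    intro z hz
    obtain ⟨x, hx⟩ := (AddCircle.homeomorphCircle (T := (1 : ℝ)) one_ne_zero).surjective
      ⟨z, by simpa [Submonoid.unitSphere] using hz⟩
    have hx' : (AddCircle.toCircle x : ℂ) = z := by
      rw [AddCircle.homeomorphCircle_apply] at hx
      rw [hx]
    have h1 := (ContinuousMap.dist_apply_le_dist (f := g) (g := q) x).trans_lt hqg
    rw [dist_eq_norm] at h1
    have h2 := (Complex.abs_re_le_norm (g x - q x)).trans_lt h1
    have h3 := hpq x
    rw [one_mul, hx'] at h3
    simpa [g, hx', h3] using h2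
  have h0 : f 0 ≤ (p 0 + (ε / 2 : ℝ)).re := by
    refine H (fun z => p z + (ε / 2 : ℝ)) (by fun_prop) fun z hz => ?_
    have := (abs_lt.1 (hclose z hz)).2
    rw [Complex.add_re, Complex.ofReal_re]
    linarith
  have hp0 : Real.circleAverage (fun z => (p z).re - ε / 2) 0 1 = (p 0).re - ε / 2 := by
    rw [Real.circleAverage_fun_sub (f₁ := fun z => (p z).re)
      (Complex.continuous_re.comp hp.continuous).continuousOn.circleIntegrable'
      (circleIntegrable_const _ _ _), Real.circleAverage_const, InnerProductSpace.HarmonicOnNhd.circleAverage_eq]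
    exact fun z _ => (hp.analyticAt z).harmonicAt_re
  have h1 : Real.circleAverage (fun z => (p z).re - ε / 2) 0 1 ≤ Real.circleAverage f 0 1 := by
    refine Real.circleAverage_mono
      ((Complex.continuous_re.comp hp.continuous).sub
        continuous_const).continuousOn.circleIntegrable'
      (hf.circleIntegrable zero_le_one) fun z hz => ?_
    rw [abs_one] at hz
    have := (abs_lt.1 (hclose z hz)).1
    linarith
  rw [Complex.add_re, Complex.ofReal_re] at h0
  linarith

/-- The local sub-mean value inequality implies the global one. -/
lemma LocSubmean.le_circleAverage {f : ℂ → ℝ} (hf : Continuous f) (hloc : ∀ c, LocSubmean f c) :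
    f 0 ≤ Real.circleAverage f 0 1 := by
  refine le_circleAverage_of_majorants hf.continuousOn fun p hp hlt => ?_
  have hm : Differentiable ℂ fun z => -p z := hp.neg
  have := LocSubmean.le_of_isCompact (f := fun z => f z + (-p z).re) (B := 0)
    (isCompact_closedBall (0 : ℂ) 1)
    (hf.add (Complex.continuous_re.comp hm.continuous)).continuousOn
    (fun c _ => (hloc c).add univ_mem hf.continuousOn
      (Complex.continuous_re.comp hm.continuous).continuousOn (locSubmean_re hm c))
    (fun z hz hzi => ?_) 0 (by simp)
  · simp at this
    linarith
  · rw [interior_closedBall _ one_ne_zero] at hzi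
    have hz' : z ∈ Metric.sphere (0 : ℂ) 1 := by
      rw [← Metric.closedBall_sdiff_ball]; exact ⟨hz, hzi⟩
    have := hlt z hz'
    simp
    linarith

/-- Liouville's theorem for subharmonic functions. -/
lemma LocSubmean.eq_of_nonpos {f : ℂ → ℝ} (hf : Continuous f) (hloc : ∀ c, LocSubmean f c)
    (hneg : ∀ z, f z ≤ 0) (z w : ℂ) : f z = f w := by
  suffices h : ∀ z w, f z ≤ f w from le_antisymm (h z w) (h w z)
  clear z w
  intro z w
  rcases eq_or_ne z w with rfl | hzw
  · exact le_rfl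
  refine le_of_forall_pos_le_add fun ε hε => ?_
  obtain ⟨s₀, hs₀, hs₀'⟩ := Metric.continuous_iff.1 hf w ε hε
  have hd : 0 < ‖z - w‖ := norm_pos_iff.2 (sub_ne_zero.2 hzw)
  set s := min (s₀ / 2) (‖z - w‖) with hs_def
  have hs : 0 < s := lt_min (by positivity) hd
  have hsz : s ≤ ‖z - w‖ := min_le_right _ _
  set m := f w + ε with hm
  have hms : ∀ x, ‖x - w‖ ≤ s → f x ≤ m := fun x hx => by
    have := hs₀' x (by rw [dist_eq_norm]; have := min_le_left (s₀ / 2) ‖z - w‖; linarith)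
    have := (abs_lt.1 (Real.dist_eq (f x) (f w) ▸ this)).2
    linarith
  -- comparison with `m + η log (‖x - w‖ / s)` on an annulus `s ≤ ‖x - w‖ ≤ R`
  have main : ∀ η > 0, f z ≤ m + η * Real.log (‖z - w‖ / s) := by
    intro η hη
    set R := max (‖z - w‖) (s * Real.exp (|m| / η)) with hR
    set K : Set ℂ := Metric.closedBall w R \ Metric.ball w s with hKdef
    have hK : IsCompact K := (isCompact_closedBall w R).diff Metric.isOpen_ball
    have hne : ∀ x ∈ K, s ≤ ‖x - w‖ := fun x hx => by
      have := hx.2; simpa [dist_eq_norm] using this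
    have hcl : ContinuousOn (fun x => Real.log ‖x - w‖) K :=
      ContinuousOn.log (by fun_prop) fun x hx => (hs.trans_le (hne x hx)).ne'
    have hharm : ∀ x ∈ K, InnerProductSpace.HarmonicAt (fun x => Real.log ‖x - w‖) x := by
      intro x hx
      exact AnalyticAt.harmonicAt_log_norm (f := fun x => x - w) (by fun_prop)
        (norm_pos_iff.1 (hs.trans_le (hne x hx)))
    have hle := LocSubmean.le_of_isCompact (f := fun x => f x + (-η) * Real.log ‖x - w‖)
      (B := m - η * Real.log s) hK (hf.continuousOn.add (continuousOn_const.mul hcl)) ?_ ?_ z ?_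
    · rw [Real.log_div hd.ne' hs.ne']
      linarith
    · intro c hc
      have hU : K ∈ 𝓝 c := mem_interior_iff_mem_nhds.1 hc
      refine (hloc c).add hU hf.continuousOn (continuousOn_const.mul hcl) ?_
      refine locSubmean_of_harmonic ?_
      filter_upwards [hU] with x hx
      exact (hharm x hx).const_smul (c := -η)
    · intro x hx hxi
      by_cases hxs : ‖x - w‖ ≤ s
      · have h1 := hms x hxs
        have h2 : ‖x - w‖ = s := le_antisymm hxs (hne x hx)
        simp only [h2]
        linarith
      · have hxR : R ≤ ‖x - w‖ := by
          by_contra! hlt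
          push Not at hxs
          refine hxi (mem_interior_iff_mem_nhds.2 ?_)
          have ho : IsOpen {y : ℂ | s < ‖y - w‖ ∧ ‖y - w‖ < R} :=
            IsOpen.and (isOpen_lt continuous_const (continuous_sub_right w).norm)
              (isOpen_lt (continuous_sub_right w).norm continuous_const)
          filter_upwards [ho.mem_nhds (show x ∈ _ from ⟨hxs, hlt⟩)] with y hy
          exact ⟨by simpa [dist_eq_norm] using hy.2.le, by simpa [dist_eq_norm] using hy.1.le⟩
        have h1 : s * Real.exp (|m| / η) ≤ ‖x - w‖ := (le_max_right _ _).trans hxR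
        have h2 := Real.log_le_log (by positivity) h1
        rw [Real.log_mul hs.ne' (Real.exp_ne_zero _), Real.log_exp] at h2
        have h3 := mul_le_mul_of_nonneg_left h2 hη.le
        have h4 : η * (|m| / η) = |m| := by field_simp
        have h5 := neg_abs_le m
        have h6 := hneg x
        linarith
    · exact ⟨by simp [dist_eq_norm, hR], by simp [dist_eq_norm, hsz]⟩
  have hlim : Tendsto (fun η : ℝ => m + η * Real.log (‖z - w‖ / s)) (𝓝[>] 0) (𝓝 m) := by
    have : Continuous fun η : ℝ => m + η * Real.log (‖z - w‖ / s) := by fun_prop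
    simpa using (this.tendsto 0).mono_left nhdsWithin_le_nhds
  exact ge_of_tendsto hlim (eventually_mem_nhdsWithin.mono fun η hη => main η hη)

/-! ### Plurisubharmonicity of real-valued functions -/

lemma circleMean_eq {g : ℂ → EReal} {f : ℂ → ℝ} (hf : CircleIntegrable f 0 1)
    (h : ∀ z ∈ Metric.sphere (0 : ℂ) 1, g z = f z) :
    circleMean g = (Real.circleAverage f 0 1 : ℝ) := by
  have hpi := Real.two_pi_pos
  set φ : ℝ → ℝ := fun t => f (circleMap 0 1 t) with hφ
  have hint : Integrable φ (volume.restrict (Ioc 0 (2 * Real.pi))) :=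
    (intervalIntegrable_iff_integrableOn_Ioc_of_le hpi.le).1 hf
  have hg : ∀ t, g (circleMap 0 1 t) = (φ t : EReal) := fun t =>
    h _ (circleMap_mem_sphere _ zero_le_one t)
  have h1 : ∀ t, (g (circleMap 0 1 t)).toENNReal = ENNReal.ofReal (φ t) := fun t => by
    rw [hg, EReal.toENNReal_of_ne_top (EReal.coe_ne_top _), EReal.toReal_coe]
  have h2 : ∀ t, (-g (circleMap 0 1 t)).toENNReal = ENNReal.ofReal (-φ t) := fun t => by
    rw [hg, ← EReal.coe_neg, EReal.toENNReal_of_ne_top (EReal.coe_ne_top _), EReal.toReal_coe]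
  have key := integral_eq_lintegral_pos_part_sub_lintegral_neg_part hint
  have fin1 : (∫⁻ t in Ioc 0 (2 * Real.pi), ENNReal.ofReal (φ t)) ≠ ∞ := hint.lintegral_lt_top.ne
  have fin2 : (∫⁻ t in Ioc 0 (2 * Real.pi), ENNReal.ofReal (-φ t)) ≠ ∞ :=
    hint.neg.lintegral_lt_top.ne
  unfold circleMean
  simp only [h1, h2]
  rw [Real.circleAverage_def, intervalIntegral.integral_of_le hpi.le, key]
  set A := ∫⁻ t in Ioc 0 (2 * Real.pi), ENNReal.ofReal (φ t)
  set B := ∫⁻ t in Ioc 0 (2 * Real.pi), ENNReal.ofReal (-φ t)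
  have hdiv : ∀ C : ℝ≥0∞, C ≠ ∞ → ((C / ENNReal.ofReal (2 * Real.pi) : ℝ≥0∞) : EReal)
      = ((C.toReal / (2 * Real.pi) : ℝ) : EReal) := by
    intro C hC
    rw [← EReal.coe_toENNReal (x := ((C.toReal / (2 * Real.pi) : ℝ) : EReal))
      (by rw [EReal.coe_nonneg]; positivity)]
    congr 1
    rw [EReal.toENNReal_of_ne_top (EReal.coe_ne_top _), EReal.toReal_coe,
      ENNReal.ofReal_div_of_pos hpi, ENNReal.ofReal_toReal hC]
  rw [hdiv A fin1, hdiv B fin2, ← EReal.coe_sub]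
  congr 1
  rw [smul_eq_mul]
  ring

/-- The real-valued function `w` satisfies the sub-mean value inequality on all closed discs
`{x + ζ ξ : |ζ| ≤ 1}` contained in `U`. -/
def SubmeanOn {E : Type*} [NormedAddCommGroup E] [NormedSpace ℂ E] (w : E → ℝ) (U : Set E) : Prop :=
  ∀ x ξ : E, (∀ ζ : ℂ, ‖ζ‖ ≤ 1 → x + ζ • ξ ∈ U) →
    w x ≤ Real.circleAverage (fun ζ => w (x + ζ • ξ)) 0 1

lemma continuousOn_disc {E : Type*} [NormedAddCommGroup E] [NormedSpace ℂ E] {w : E → ℝ}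
    {U : Set E} (hw : ContinuousOn w U) {x ξ : E} (hd : ∀ ζ : ℂ, ‖ζ‖ ≤ 1 → x + ζ • ξ ∈ U) :
    ContinuousOn (fun ζ : ℂ => w (x + ζ • ξ)) (Metric.sphere 0 1) :=
  hw.comp (by fun_prop) fun ζ hζ => hd ζ (mem_sphere_zero_iff_norm.1 hζ).le

lemma SubmeanOn.add {E : Type*} [NormedAddCommGroup E] [NormedSpace ℂ E] {v w : E → ℝ} {U : Set E}
    (hv : ContinuousOn v U) (hw : ContinuousOn w U)
    (h1 : SubmeanOn v U) (h2 : SubmeanOn w U) : SubmeanOn (fun x => v x + w x) U := by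
  intro x ξ hd
  rw [Real.circleAverage_fun_add ((continuousOn_disc hv hd).circleIntegrable zero_le_one)
    ((continuousOn_disc hw hd).circleIntegrable zero_le_one)]
  exact add_le_add (h1 x ξ hd) (h2 x ξ hd)

lemma SubmeanOn.isPSHOn {n : ℕ} {w : EuclideanSpace ℂ (Fin n) → ℝ}
    {U : Set (EuclideanSpace ℂ (Fin n))} (hw : ContinuousOn w U) (h : SubmeanOn w U) :
    IsPSHOn (fun x => (w x : EReal)) U where
  lt_top _ _ := EReal.coe_lt_top _
  usc := (continuous_coe_real_ereal.comp_continuousOn hw).upperSemicontinuousOn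
  le_circleMean x ξ hd := by
    rw [circleMean_eq ((continuousOn_disc hw hd).circleIntegrable zero_le_one) fun _ _ => rfl]
    exact EReal.coe_le_coe_iff.2 (h x ξ hd)

lemma IsPSHOn.submeanOn {n : ℕ} {f : EuclideanSpace ℂ (Fin n) → EReal}
    {w : EuclideanSpace ℂ (Fin n) → ℝ} {U : Set (EuclideanSpace ℂ (Fin n))}
    (hw : ContinuousOn w U) (hfw : ∀ x ∈ U, f x = w x) (h : IsPSHOn f U) : SubmeanOn w U := by
  intro x ξ hd
  have h1 := h.le_circleMean x ξ hd
  rw [circleMean_eq (f := fun ζ => w (x + ζ • ξ))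
    ((continuousOn_disc hw hd).circleIntegrable zero_le_one)
    (fun z hz => hfw _ (hd z (mem_sphere_zero_iff_norm.1 hz).le)),
    hfw x (by simpa using hd 0 (by simp))] at h1
  exact EReal.coe_le_coe_iff.1 h1

/-- The limit of a decreasing sequence of continuous plurisubharmonic functions that is bounded
from below is plurisubharmonic. -/
lemma isPSHOn_iInf {n : ℕ} {w : ℕ → EuclideanSpace ℂ (Fin n) → ℝ}
    {U : Set (EuclideanSpace ℂ (Fin n))} {B : ℝ} (hw : ∀ N, ContinuousOn (w N) U)
    (hanti : ∀ x ∈ U, Antitone fun N => w N x) (hB : ∀ N, ∀ x ∈ U, B ≤ w N x)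
    (h : ∀ N, SubmeanOn (w N) U) : IsPSHOn (fun x => ((⨅ N, w N x : ℝ) : EReal)) U where
  lt_top _ _ := EReal.coe_lt_top _
  usc := by
    intro x hx y hy
    obtain ⟨r, hr, hry⟩ := EReal.lt_iff_exists_real_btwn.1 hy
    obtain ⟨N, hN⟩ := exists_lt_of_ciInf_lt (EReal.coe_lt_coe_iff.1 hr)
    have := (hw N x hx).eventually (gt_mem_nhds hN)
    filter_upwards [this, eventually_mem_nhdsWithin] with z hz hzU
    refine lt_of_le_of_lt (EReal.coe_le_coe_iff.2 ?_) hry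
    exact (ciInf_le ⟨B, by rintro _ ⟨N, rfl⟩; exact hB N z hzU⟩ N).trans hz.le
  le_circleMean x ξ hd := by
    have hbdd : ∀ z ∈ U, BddBelow (range fun N => w N z) := fun z hz =>
      ⟨B, by rintro _ ⟨N, rfl⟩; exact hB N z hz⟩
    have hmem : ∀ t : ℝ, x + circleMap 0 1 t • ξ ∈ U := fun t => hd _ (by simp)
    have hc : ∀ N, Continuous fun t : ℝ => w N (x + circleMap 0 1 t • ξ) := fun N =>
      (hw N).comp_continuous (by fun_prop) hmem
    have hlim : ∀ t : ℝ, Tendsto (fun N => w N (x + circleMap 0 1 t • ξ)) atTop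
        (𝓝 (⨅ N, w N (x + circleMap 0 1 t • ξ))) := fun t =>
      tendsto_atTop_ciInf (hanti _ (hmem t)) (hbdd _ (hmem t))
    obtain ⟨D, hD⟩ := (isCompact_Icc (a := (0 : ℝ)) (b := 2 * Real.pi)).exists_bound_of_continuousOn
      (hc 0).continuousOn
    have hbound : ∀ N, ∀ t ∈ Icc 0 (2 * Real.pi), ‖w N (x + circleMap 0 1 t • ξ)‖ ≤ max |B| D := by
      intro N t ht
      rw [Real.norm_eq_abs, abs_le]
      constructor
      · have h1 := hB N _ (hmem t)
        have h2 := neg_abs_le B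
        have h3 := le_max_left |B| D
        linarith
      · have h1 := hanti _ (hmem t) (Nat.zero_le N)
        have h2 := (abs_le.1 (hD t ht)).2
        exact (h1.trans h2).trans (le_max_right _ _)
    have hsub : uIoc 0 (2 * Real.pi) ⊆ Icc 0 (2 * Real.pi) := by
      rw [uIoc_of_le Real.two_pi_pos.le]; exact Ioc_subset_Icc_self
    have hmeas : AEStronglyMeasurable (fun t : ℝ => ⨅ N, w N (x + circleMap 0 1 t • ξ))
        (volume.restrict (uIoc 0 (2 * Real.pi))) :=
      aestronglyMeasurable_of_tendsto_ae atTop (fun N => (hc N).aestronglyMeasurable)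
        (Eventually.of_forall hlim)
    have hint : CircleIntegrable (fun ζ : ℂ => ⨅ N, w N (x + ζ • ξ)) 0 1 := by
      refine (intervalIntegrable_const (c := max |B| D)).mono_fun hmeas ?_
      refine (ae_restrict_iff' measurableSet_uIoc).2 (Eventually.of_forall fun t ht => ?_)
      refine (le_of_tendsto (hlim t).norm
        (Eventually.of_forall fun N => hbound N t (hsub ht))).trans (le_abs_self _)
    have hconv : Tendsto (fun N => Real.circleAverage (fun ζ => w N (x + ζ • ξ)) 0 1) atTop
        (𝓝 (Real.circleAverage (fun ζ : ℂ => ⨅ N, w N (x + ζ • ξ)) 0 1)) := by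
      simp only [Real.circleAverage_def]
      refine Tendsto.const_smul ?_ _
      refine intervalIntegral.tendsto_integral_filter_of_dominated_convergence
        (fun _ => max |B| D) (Eventually.of_forall fun N => (hc N).aestronglyMeasurable)
        (Eventually.of_forall fun N => Eventually.of_forall fun t ht => hbound N t (hsub ht))
        intervalIntegrable_const (Eventually.of_forall fun t _ => hlim t)
    rw [circleMean_eq hint fun _ _ => rfl]
    have hx : x ∈ U := by simpa using hd 0 (by simp)
    exact EReal.coe_le_coe_iff.2 <| ge_of_tendsto' hconv fun N =>
      (ciInf_le (hbdd x hx) N).trans (h N x ξ hd)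

lemma submeanOn_normSq {E : Type*} [NormedAddCommGroup E] [InnerProductSpace ℂ E] (U : Set E) :
    SubmeanOn (fun x : E => ‖x‖ ^ 2) U := by
  intro x ξ _
  simpa using normSq_le_circleAverage (F := fun ζ : ℂ => x + ζ • ξ) (by fun_prop) 0 1

/-! ### Smooth perturbations -/

lemma circleAverage_normSq {E : Type*} [NormedAddCommGroup E] [InnerProductSpace ℂ E] (x ξ : E) :
    Real.circleAverage (fun ζ : ℂ => ‖x + ζ • ξ‖ ^ 2) 0 1 = ‖x‖ ^ 2 + ‖ξ‖ ^ 2 := by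
  have hp : Differentiable ℂ fun ζ : ℂ => (‖x‖ ^ 2 + ‖ξ‖ ^ 2 : ℂ) + 2 * (ζ * inner ℂ x ξ) := by
    fun_prop
  rw [Real.circleAverage_congr_sphere
    (f₂ := fun ζ => ((‖x‖ ^ 2 + ‖ξ‖ ^ 2 : ℂ) + 2 * (ζ * inner ℂ x ξ)).re),
    InnerProductSpace.HarmonicOnNhd.circleAverage_eq]
  · simp
    norm_cast
  · exact fun z _ => (hp.analyticAt z).harmonicAt_re
  · intro ζ hζ
    rw [abs_one, mem_sphere_zero_iff_norm] at hζ
    simp only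
    rw [@norm_add_sq ℂ, norm_smul, hζ, inner_smul_right]
    simp only [RCLike.re_to_complex, Complex.mul_re, Complex.add_re, Complex.re_ofNat,
      Complex.im_ofNat, ← Complex.ofReal_pow, Complex.ofReal_re]
    ring

/-- The mean value of a test function over a disc of radius `‖ξ‖` differs from its value at the
center by an error that is at most quadratic in the radius. -/
lemma exists_abs_circleAverage_sub_le {E : Type*} [NormedAddCommGroup E] [NormedSpace ℂ E] {θ : E → ℝ}
    (hθ : ContDiff ℝ 2 θ) (hc : HasCompactSupport θ) : ∃ K : ℝ, 0 ≤ K ∧ ∀ x ξ : E,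
      |Real.circleAverage (fun ζ : ℂ => θ (x + ζ • ξ)) 0 1 - θ x| ≤ K * ‖ξ‖ ^ 2 := by
  have hd : ContDiff ℝ 1 (fderiv ℝ θ) := hθ.fderiv_right (by norm_num)
  obtain ⟨K, hK⟩ := hd.lipschitzWith_of_hasCompactSupport (hc.fderiv ℝ) one_ne_zero
  refine ⟨K, K.2, fun x ξ => ?_⟩
  have hdiff : Differentiable ℝ θ := hθ.differentiable (by norm_num)
  have taylor : ∀ v : E, |θ (x + v) - (θ x + fderiv ℝ θ x v)| ≤ K * ‖v‖ ^ 2 := by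
    intro v
    have := (convex_closedBall x ‖v‖).norm_image_sub_le_of_norm_hasFDerivWithin_le'
      (f := θ) (f' := fderiv ℝ θ) (φ := fderiv ℝ θ x) (C := K * ‖v‖) (x := x) (y := x + v)
      (fun y _ => (hdiff y).hasFDerivAt.hasFDerivWithinAt)
      (fun y hy => (hK.norm_sub_le y x).trans
        (mul_le_mul_of_nonneg_left (by simpa [dist_eq_norm] using hy) K.2))
      (by simp) (by simp [dist_eq_norm])
    rw [add_sub_cancel_left, Real.norm_eq_abs] at this
    rw [← sub_sub, sq, ← mul_assoc]
    exact this
  let ℓ : ℂ →L[ℝ] ℝ :=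
    (fderiv ℝ θ x).comp ((ContinuousLinearMap.toSpanSingleton ℂ ξ).restrictScalars ℝ)
  have hℓ : Real.circleAverage (fun ζ => ℓ ζ) 0 1 = 0 := by
    have h1 := ℓ.circleAverage_comp_comm (circleIntegrable_id 0 1)
    have h2 : Real.circleAverage (fun z : ℂ => z) 0 1 = 0 :=
      DiffContOnCl.circleAverage (f := fun z : ℂ => z) differentiable_id.diffContOnCl
    rw [h2, map_zero] at h1
    exact h1
  have hcont : Continuous fun ζ : ℂ => θ (x + ζ • ξ) := hθ.continuous.comp (by fun_prop)
  have hlin : Continuous fun ζ : ℂ => θ x + ℓ ζ := by fun_prop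
  have heq : Real.circleAverage (fun ζ : ℂ => θ (x + ζ • ξ)) 0 1 - θ x
      = Real.circleAverage (fun ζ : ℂ => θ (x + ζ • ξ) - (θ x + ℓ ζ)) 0 1 := by
    rw [Real.circleAverage_fun_sub hcont.continuousOn.circleIntegrable'
      hlin.continuousOn.circleIntegrable', Real.circleAverage_fun_add
      (circleIntegrable_const _ _ _) ℓ.continuous.continuousOn.circleIntegrable', hℓ,
      Real.circleAverage_const, add_zero]
  rw [heq]
  refine Real.abs_circleAverage_le_circleAverage_abs.trans
    (Real.circleAverage_mono_on_of_le_circle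
      (hcont.sub hlin).abs.continuousOn.circleIntegrable' fun ζ hζ => ?_)
  rw [abs_one, mem_sphere_zero_iff_norm] at hζ
  have := taylor (ζ • ξ)
  rwa [norm_smul, hζ, one_mul] at this

/-- `‖x‖²` remains plurisubharmonic under small smooth perturbations. -/
lemma exists_submeanOn_normSq_add {E : Type*} [NormedAddCommGroup E] [InnerProductSpace ℂ E]
    {θ : E → ℝ} (hθ : ContDiff ℝ 2 θ) (hc : HasCompactSupport θ) :
    ∃ ε₀ : ℝ, 0 < ε₀ ∧ ∀ ε ∈ Ioo (-ε₀) ε₀, ∀ U : Set E,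
      SubmeanOn (fun x => ‖x‖ ^ 2 + ε * θ x) U := by
  obtain ⟨K, hK, h⟩ := exists_abs_circleAverage_sub_le hθ hc
  refine ⟨(K + 1)⁻¹, by positivity, fun ε hε U x ξ _ => ?_⟩
  have hcont : Continuous fun ζ : ℂ => ε * θ (x + ζ • ξ) :=
    continuous_const.mul (hθ.continuous.comp (by fun_prop))
  have hcn : Continuous fun ζ : ℂ => ‖x + ζ • ξ‖ ^ 2 := by fun_prop
  have hsm : Real.circleAverage (fun ζ : ℂ => ε * θ (x + ζ • ξ)) 0 1
      = ε * Real.circleAverage (fun ζ : ℂ => θ (x + ζ • ξ)) 0 1 :=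
    Real.circleAverage_fun_smul (f := fun ζ : ℂ => θ (x + ζ • ξ)) (c := 0) (R := 1) (a := ε)
  simp only
  rw [Real.circleAverage_fun_add hcn.continuousOn.circleIntegrable'
    hcont.continuousOn.circleIntegrable', circleAverage_normSq, hsm]
  set A := Real.circleAverage (fun ζ : ℂ => θ (x + ζ • ξ)) 0 1
  have hε' : |ε| * K ≤ 1 := by
    have := (abs_lt.2 hε).le
    calc |ε| * K ≤ (K + 1)⁻¹ * (K + 1) := by gcongr; linarith
      _ = 1 := inv_mul_cancel₀ (by positivity)
  have h1 : |ε * (A - θ x)| ≤ ‖ξ‖ ^ 2 := by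
    rw [abs_mul]
    calc |ε| * |A - θ x| ≤ |ε| * (K * ‖ξ‖ ^ 2) := by gcongr; exact h x ξ
      _ = |ε| * K * ‖ξ‖ ^ 2 := by ring
      _ ≤ 1 * ‖ξ‖ ^ 2 := by gcongr
      _ = ‖ξ‖ ^ 2 := one_mul _
  have := (abs_le.1 h1).1
  linarith

/-! ### Pseudoconvexity through analytic discs -/

/-- An analytic disc that is entire and has its boundary circle in `V` lies in `V`. -/
def DiscConvex {E : Type*} [NormedAddCommGroup E] [NormedSpace ℂ E] (V : Set E) : Prop :=
  ∀ F : ℂ → E, Differentiable ℂ F → (∀ ζ ∈ Metric.sphere (0 : ℂ) 1, F ζ ∈ V) →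
    ∀ ζ ∈ Metric.closedBall (0 : ℂ) 1, F ζ ∈ V

lemma subset_connectedComponentIn_of_mem {E : Type*} [TopologicalSpace E] {V S : Set E} {x₀ y : E} (hS : IsPreconnected S)
    (hSV : S ⊆ V) (hy : y ∈ S) (hyx : y ∈ connectedComponentIn V x₀) :
    S ⊆ connectedComponentIn V x₀ := by
  rw [connectedComponentIn_eq hyx]
  exact hS.subset_connectedComponentIn hy hSV

/-- Minus the logarithm of the boundary distance is plurisubharmonic. If a harmonic polynomial
`Re p` majorises it on the boundary of a disc, then the discs obtained by moving that disc by
`t exp (-p) η` with `t ∈ [0, 1]`, `‖η‖ < 1` have their boundaries inside the domain. -/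
lemma DiscConvex.submeanOn_neg_log_infDist {E : Type*} [NormedAddCommGroup E] [NormedSpace ℂ E]
    {V : Set E} (hV : DiscConvex V) (hVo : IsOpen V)
    (x₀ : E) : SubmeanOn
      (fun x => -Real.log (Metric.infDist x (connectedComponentIn V x₀)ᶜ))
      (connectedComponentIn V x₀) := by
  intro x ξ hd
  have hlc : LocallyConnectedSpace E :=
    let _ := NormedSpace.restrictScalars ℝ ℂ E
    inferInstance
  set Ω := connectedComponentIn V x₀ with hΩ
  have hΩo : IsOpen Ω := hVo.connectedComponentIn
  rcases (Ωᶜ).eq_empty_or_nonempty with he | hne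
  · simp [he, Real.circleAverage_const]
  have hpos : ∀ y ∈ Ω, 0 < Metric.infDist y Ωᶜ := fun y hy =>
    (hΩo.isClosed_compl.notMem_iff_infDist_pos hne).1 (by simpa using hy)
  have hcont : ContinuousOn (fun ζ : ℂ => -Real.log (Metric.infDist (x + ζ • ξ) Ωᶜ))
      (Metric.sphere 0 1) := by
    refine (ContinuousOn.log ?_ fun ζ hζ => ?_).neg
    · exact ((Metric.continuous_infDist_pt _).comp (by fun_prop)).continuousOn
    · exact (hpos _ (hd ζ (mem_sphere_zero_iff_norm.1 hζ).le)).ne'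
  have hx : x ∈ Ω := by simpa using hd 0 (by simp)
  have main := le_circleAverage_of_majorants hcont fun p hp hlt => ?_
  · simpa using main
  simp only [zero_smul, add_zero]
  suffices h : Real.exp (-(p 0).re) ≤ Metric.infDist x Ωᶜ by
    have := Real.log_le_log (Real.exp_pos _) h
    rw [Real.log_exp] at this
    linarith
  refine (Metric.le_infDist hne).2 fun {y} hy => ?_
  by_contra! hlt'
  refine hy ?_
  set η : E := Complex.exp (p 0) • (y - x) with hη
  have hη1 : ‖η‖ < 1 := by
    rw [hη, norm_smul, Complex.norm_exp, ← dist_eq_norm, dist_comm]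
    calc Real.exp (p 0).re * dist x y < Real.exp (p 0).re * Real.exp (-(p 0).re) := by gcongr
      _ = 1 := by rw [← Real.exp_add]; simp
  let F : ℝ → ℂ → E := fun t ζ => x + ζ • ξ + ((t : ℂ) * Complex.exp (-p ζ)) • η
  have hFd : ∀ t, Differentiable ℂ (F t) := fun t => by
    change Differentiable ℂ fun ζ => x + ζ • ξ + ((t : ℂ) * Complex.exp (-p ζ)) • η
    fun_prop
  have hbd : ∀ t ∈ Icc (0 : ℝ) 1, ∀ ζ ∈ Metric.sphere (0 : ℂ) 1, F t ζ ∈ Ω := by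
    intro t ht ζ hζ
    by_contra hcon
    have h1 := Metric.infDist_le_dist_of_mem (x := x + ζ • ξ) (show F t ζ ∈ Ωᶜ from hcon)
    have h2 : dist (x + ζ • ξ) (F t ζ) ≤ Real.exp (-(p ζ).re) := by
      rw [dist_comm, dist_eq_norm]
      simp only [F, add_sub_cancel_left]
      rw [norm_smul, norm_mul, Complex.norm_exp, Complex.norm_real, Real.norm_eq_abs,
        abs_of_nonneg ht.1, Complex.neg_re]
      have := Real.exp_pos (-(p ζ).re)
      calc t * Real.exp (-(p ζ).re) * ‖η‖ ≤ 1 * Real.exp (-(p ζ).re) * 1 := by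
            gcongr
            exact ht.2
        _ = _ := by ring
    have h3 := Real.log_le_log (hpos _ (hd ζ (mem_sphere_zero_iff_norm.1 hζ).le)) (h1.trans h2)
    rw [Real.log_exp] at h3
    have := hlt ζ hζ
    linarith
  have hsub : ∀ t ∈ Icc (0 : ℝ) 1, ∀ ζ ∈ Metric.closedBall (0 : ℂ) 1, F t ζ ∈ V :=
    fun t ht => hV (F t) (hFd t) fun ζ hζ => connectedComponentIn_subset V x₀ (hbd t ht ζ hζ)
  have hconn : IsPreconnected ((fun q : ℝ × ℂ => F q.1 q.2) ''
      (Icc (0 : ℝ) 1 ×ˢ Metric.closedBall (0 : ℂ) 1)) := by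
    refine (isPreconnected_Icc.prod (convex_closedBall (0 : ℂ) 1).isPreconnected).image _ ?_
    have hpc := hp.continuous
    exact Continuous.continuousOn (by
      change Continuous fun q : ℝ × ℂ =>
        x + q.2 • ξ + ((q.1 : ℂ) * Complex.exp (-p q.2)) • η
      fun_prop)
  refine subset_connectedComponentIn_of_mem hconn ?_ (y := x) ⟨(0, 0), by simp, by simp [F]⟩ hx
    ⟨(1, 0), by simp, ?_⟩
  · rintro _ ⟨q, hq, rfl⟩
    exact hsub q.1 hq.1 q.2 hq.2
  · simp [F, hη, smul_smul, ← Complex.exp_add]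

lemma DiscConvex.isPseudoconvexDomain {n : ℕ} {V : Set (EuclideanSpace ℂ (Fin n))}
    (hV : DiscConvex V) (hVo : IsOpen V) {x₀ : EuclideanSpace ℂ (Fin n)} (hx₀ : x₀ ∈ V) :
    IsPseudoconvexDomain (connectedComponentIn V x₀) := by
  have hsub := hV.submeanOn_neg_log_infDist hVo x₀
  have hΩo : IsOpen (connectedComponentIn V x₀) := hVo.connectedComponentIn
  refine ⟨hΩo, isConnected_connectedComponentIn_iff.2 hx₀, ?_⟩
  generalize connectedComponentIn V x₀ = Ω at hsub hΩo
  have hc1 : Continuous fun x : EuclideanSpace ℂ (Fin n) => ‖x‖ ^ 2 := by fun_prop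
  have hdc : Continuous fun x => Metric.infDist x Ωᶜ := Metric.continuous_infDist_pt _
  have hc2 : ContinuousOn (fun x => -Real.log (Metric.infDist x Ωᶜ)) Ω := by
    rcases (Ωᶜ).eq_empty_or_nonempty with he | hne
    · simp only [he, Metric.infDist_empty]
      exact continuousOn_const
    · exact (hdc.continuousOn.log fun y hy =>
        ((hΩo.isClosed_compl.notMem_iff_infDist_pos hne).1 (by simpa using hy)).ne').neg
  refine ⟨fun x => ‖x‖ ^ 2 + -Real.log (Metric.infDist x Ωᶜ), hc1.continuousOn.add hc2,
    ((submeanOn_normSq Ω).add hc1.continuousOn hc2 hsub).isPSHOn (hc1.continuousOn.add hc2),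
    fun c => ?_⟩
  rcases (Ωᶜ).eq_empty_or_nonempty with he | hne
  · have : Ω = univ := compl_empty_iff.1 he
    subst this
    refine Metric.isCompact_of_isClosed_isBounded ?_ ?_
    · simpa using isClosed_le hc1 continuous_const
    · refine (Metric.isBounded_closedBall (x := 0) (r := |c| + 1)).subset fun x hx => ?_
      have h1 : ‖x‖ ^ 2 ≤ c := by simpa using hx
      have h2 := le_abs_self c
      rw [mem_closedBall_zero_iff]
      nlinarith [norm_nonneg x, abs_nonneg c]
  · have heq : {z | z ∈ Ω ∧ ‖z‖ ^ 2 + -Real.log (Metric.infDist z Ωᶜ) ≤ c}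
        = {z | Real.exp (‖z‖ ^ 2 - c) ≤ Metric.infDist z Ωᶜ} := by
      ext z
      simp only [mem_ofPred_eq]
      constructor
      · rintro ⟨hz, hle⟩
        have hp := (hΩo.isClosed_compl.notMem_iff_infDist_pos hne).1 (by simpa using hz)
        rw [← Real.le_log_iff_exp_le hp]
        linarith
      · intro hle
        have hp := (Real.exp_pos _).trans_le hle
        rw [← Real.le_log_iff_exp_le hp] at hle
        refine ⟨?_, by linarith⟩
        simpa using (hΩo.isClosed_compl.notMem_iff_infDist_pos hne).2 hp
    obtain ⟨p, hp⟩ := hne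
    refine Metric.isCompact_of_isClosed_isBounded ?_ ?_
    · rw [heq]
      exact isClosed_le (Real.continuous_exp.comp (hc1.sub continuous_const)) hdc
    · refine (Metric.isBounded_closedBall (x := 0) (r := |c| + ‖p‖ + 1)).subset fun x hx => ?_
      rw [heq, mem_ofPred_eq] at hx
      have h1 := Metric.infDist_le_dist_of_mem (x := x) hp
      have h2 := Real.add_one_le_exp (‖x‖ ^ 2 - c)
      have h3 : dist x p ≤ ‖x‖ + ‖p‖ := dist_le_norm_add_norm x p
      have h4 := le_abs_self c
      rw [mem_closedBall_zero_iff]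
      nlinarith [norm_nonneg x, norm_nonneg p, abs_nonneg c]

/-! ### The potential -/

section
variable {E : Type*} [NormedAddCommGroup E] [InnerProductSpace ℂ E]

/-- A truncation of `∑ₖ 2⁻ᵏ⁻¹ log |1 - ⟨aₖ, x⟩|`. The summand `2⁻ᴺ (1 + ‖x‖²)`, which tends to `0`,
dominates the term that is added to the sum in the passage from `N` to `N + 1`; it makes the
sequence decreasing in `N`. The constant `201` makes `potential a 0` negative exactly on the ball of
radius `10`. -/
noncomputable def logPotential (a : ℕ → E) (N : ℕ) (x : E) : ℝ :=
  ∑ k ∈ Finset.range N, (1 / 2) ^ (k + 1) * truncLog N (1 - inner ℂ (a k) x)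
    + (1 / 2) ^ N * (1 + ‖x‖ ^ 2) - 201

/-- The decreasing sequence of continuous strictly plurisubharmonic functions whose limit defines
the domain as a sublevel set. -/
noncomputable def potential (a : ℕ → E) (N : ℕ) (x : E) : ℝ :=
  logPotential a N x + ‖x‖ ^ 2

lemma continuous_logPotential (a : ℕ → E) (N : ℕ) : Continuous (logPotential a N) := by
  have := continuous_truncLog N
  unfold logPotential
  fun_prop

lemma continuous_potential (a : ℕ → E) (N : ℕ) : Continuous (potential a N) :=
  (continuous_logPotential a N).add (by fun_prop)

lemma truncLog_one_sub_inner_le {a : E} (ha : ‖a‖ ≤ 1) (x : E) {T : ℝ} (hT : 0 ≤ T) :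
    truncLog T (1 - inner ℂ a x) ≤ 1 + ‖x‖ ^ 2 := by
  have h1 : max ‖1 - inner ℂ a x‖ (Real.exp (-T)) ≤ 1 + ‖x‖ := by
    refine max_le ?_ ?_
    · refine (norm_sub_le _ _).trans ?_
      have := norm_inner_le_norm (𝕜 := ℂ) a x
      rw [norm_one]
      nlinarith [norm_nonneg x]
    · have : Real.exp (-T) ≤ 1 := Real.exp_le_one_iff.2 (by linarith)
      linarith [norm_nonneg x]
  have h2 := Real.log_le_sub_one_of_pos
    (lt_max_of_lt_right (Real.exp_pos (-T)) : 0 < max ‖1 - inner ℂ a x‖ (Real.exp (-T)))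
  unfold truncLog
  nlinarith [sq_nonneg (‖x‖ - 1)]

lemma antitone_potential {a : ℕ → E} (ha : ∀ k, ‖a k‖ ≤ 1) (x : E) :
    Antitone fun N => potential a N x := by
  refine antitone_nat_of_succ_le fun N => ?_
  unfold potential logPotential
  rw [Finset.sum_range_succ]
  have h1 : ∑ k ∈ Finset.range N, (1 / 2 : ℝ) ^ (k + 1) * truncLog (N + 1 : ℕ) (1 - inner ℂ (a k) x)
      ≤ ∑ k ∈ Finset.range N, (1 / 2 : ℝ) ^ (k + 1) * truncLog N (1 - inner ℂ (a k) x) := by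
    refine Finset.sum_le_sum fun k _ => mul_le_mul_of_nonneg_left ?_ (by positivity)
    exact truncLog_antitone _ (by push_cast; linarith)
  have h2 : (1 / 2 : ℝ) ^ (N + 1) * truncLog (N + 1 : ℕ) (1 - inner ℂ (a N) x)
      ≤ (1 / 2 : ℝ) ^ (N + 1) * (1 + ‖x‖ ^ 2) :=
    mul_le_mul_of_nonneg_left (truncLog_one_sub_inner_le (ha N) x (by positivity)) (by positivity)
  have h3 : (1 / 2 : ℝ) ^ N = 2 * (1 / 2) ^ (N + 1) := by ring
  rw [h3]
  linarith

lemma locSubmean_normSq {F : ℂ → E} (hF : Differentiable ℂ F) (c : ℂ) :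
    LocSubmean (fun ζ => ‖F ζ‖ ^ 2) c :=
  Eventually.of_forall fun r => normSq_le_circleAverage hF c r

lemma locSubmean_logPotential (a : ℕ → E) (N : ℕ) {F : ℂ → E} (hF : Differentiable ℂ F) (c : ℂ) :
    LocSubmean (fun ζ => logPotential a N (F ζ)) c := by
  have hterm : ∀ k, Differentiable ℂ fun ζ => 1 - inner ℂ (a k) (F ζ) := fun k =>
    (differentiable_const _).sub ((innerSL ℂ (a k)).differentiable.comp hF)
  have hct : ∀ k, Continuous fun ζ => truncLog N (1 - inner ℂ (a k) (F ζ)) := fun k =>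
    (continuous_truncLog N).comp (hterm k).continuous
  have hFc := hF.continuous
  have hsum : ∀ s : Finset ℕ, LocSubmean
      (fun ζ => ∑ k ∈ s, (1 / 2 : ℝ) ^ (k + 1) * truncLog N (1 - inner ℂ (a k) (F ζ))) c := by
    intro s
    induction s using Finset.induction_on with
    | empty => simpa using locSubmean_const 0 c
    | insert k s hk ih =>
      simp only [Finset.sum_insert hk]
      refine LocSubmean.add univ_mem (Continuous.continuousOn (by fun_prop))
        (Continuous.continuousOn (by fun_prop))
        ((locSubmean_truncLog (hterm k) N c).const_mul (by positivity)) ih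
  have h1 := LocSubmean.add univ_mem (Continuous.continuousOn (by fun_prop))
        (Continuous.continuousOn (by fun_prop)) (hsum (Finset.range N))
    ((LocSubmean.add univ_mem (Continuous.continuousOn (by fun_prop))
        (Continuous.continuousOn (by fun_prop)) (locSubmean_const 1 c)
      (locSubmean_normSq hF c)).const_mul (a := (1 / 2 : ℝ) ^ N) (by positivity))
  have h2 := LocSubmean.add univ_mem (Continuous.continuousOn (by fun_prop))
        (Continuous.continuousOn (by fun_prop)) h1 (locSubmean_const (-201) c)
  simpa only [logPotential, sub_eq_add_neg] using h2

lemma locSubmean_max_potential (a : ℕ → E) (N : ℕ) (M : ℝ) {F : ℂ → E} (hF : Differentiable ℂ F)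
    (c : ℂ) : LocSubmean (fun ζ => max (potential a N (F ζ)) (-M)) c := by
  have h1 : Continuous fun ζ => logPotential a N (F ζ) :=
    (continuous_logPotential a N).comp hF.continuous
  have h2 : Continuous fun ζ => ‖F ζ‖ ^ 2 := hF.continuous.norm.pow 2
  exact locSubmean_max univ_mem (h1.add h2).continuousOn continuousOn_const
    (LocSubmean.add univ_mem h1.continuousOn h2.continuousOn
      (locSubmean_logPotential a N hF c) (locSubmean_normSq hF c)) (locSubmean_const _ _)

lemma submeanOn_of_locSubmean {w : E → ℝ} (hw : Continuous w)
    (h : ∀ F : ℂ → E, Differentiable ℂ F → ∀ c, LocSubmean (fun ζ => w (F ζ)) c) (U : Set E) :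
    SubmeanOn w U := by
  intro x ξ _
  have := LocSubmean.le_circleAverage (f := fun ζ => w (x + ζ • ξ)) (hw.comp (by fun_prop))
    (h _ (by fun_prop))
  simpa using this

/-- The sublevel set at `0` of the limit of the potentials. -/
def sublevel (a : ℕ → E) : Set E := {x | ∃ N, potential a N x < 0}

lemma isOpen_sublevel (a : ℕ → E) : IsOpen (sublevel a) := by
  have : sublevel a = ⋃ N, {x | potential a N x < 0} := by
    ext; simp [sublevel]
  rw [this]
  exact isOpen_iUnion fun N => isOpen_lt (continuous_potential a N) continuous_const

lemma discConvex_sublevel {a : ℕ → E} (ha : ∀ k, ‖a k‖ ≤ 1) : DiscConvex (sublevel a) := by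
  intro F hF hbd
  -- one index `N` serves the whole boundary circle, by compactness and monotonicity
  obtain ⟨N, hN⟩ : ∃ N, ∀ ζ ∈ Metric.sphere (0 : ℂ) 1, potential a N (F ζ) < 0 := by
    have hc := (isCompact_sphere (0 : ℂ) 1).elim_directed_cover
      (fun N => {ζ | potential a N (F ζ) < 0})
      (fun N => isOpen_lt ((continuous_potential a N).comp hF.continuous) continuous_const)
      (fun ζ hζ => mem_iUnion.2 (hbd ζ hζ))
      (directed_of_isDirected_le fun m k hmk ζ hζ =>
        (antitone_potential ha (F ζ) hmk).trans_lt hζ)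
    exact hc
  have hcN : Continuous fun ζ => potential a N (F ζ) :=
    (continuous_potential a N).comp hF.continuous
  obtain ⟨z, hz, hmax⟩ := (isCompact_sphere (0 : ℂ) 1).exists_isMaxOn ⟨1, by simp⟩
    hcN.continuousOn
  set B := max (potential a N (F z)) (-1)
  have hB : B < 0 := max_lt (hN z hz) (by norm_num)
  intro ζ hζ
  refine ⟨N, (le_max_left _ (-1)).trans_lt <| lt_of_le_of_lt ?_ hB⟩
  refine LocSubmean.le_of_isCompact (isCompact_closedBall (0 : ℂ) 1)
    (f := fun ζ => max (potential a N (F ζ)) (-1)) (hcN.max continuous_const).continuousOn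
    (fun c _ => locSubmean_max_potential a N 1 hF c) (fun w hw hwi => ?_) ζ hζ
  rw [interior_closedBall _ one_ne_zero] at hwi
  have hw' : w ∈ Metric.sphere (0 : ℂ) 1 := by
    rw [← Metric.closedBall_sdiff_ball]; exact ⟨hw, hwi⟩
  exact max_le_max (hmax hw') le_rfl

lemma ball_subset_sublevel (a : ℕ → E) : Metric.ball 0 10 ⊆ sublevel a := by
  intro x hx
  rw [mem_ball_zero_iff] at hx
  refine ⟨0, ?_⟩
  simp only [potential, logPotential, Finset.range_zero, Finset.sum_empty, pow_zero]
  nlinarith [norm_nonneg x]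

lemma sum_half_pow_le_one (N : ℕ) : ∑ k ∈ Finset.range N, (1 / 2 : ℝ) ^ (k + 1) ≤ 1 := by
  have : ∑ k ∈ Finset.range N, (1 / 2 : ℝ) ^ (k + 1) = 1 - (1 / 2) ^ N := by
    induction N with
    | zero => simp
    | succ N ih => rw [Finset.sum_range_succ, ih]; ring
  rw [this]
  have : (0 : ℝ) ≤ (1 / 2) ^ N := by positivity
  linarith

lemma hyperplane_subset_sublevel {a : ℕ → E} (ha : ∀ k, ‖a k‖ ≤ 1) (k : ℕ) :
    {x | inner ℂ (a k) x = 1} ⊆ sublevel a := by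
  intro x hx
  set T := 1 + ‖x‖ ^ 2 with hT
  have hT0 : 0 ≤ T := by positivity
  obtain ⟨m, hm⟩ := exists_nat_gt (2 ^ (k + 1) * (3 * T))
  set N := max m (k + 1) with hN
  have hkN : k ∈ Finset.range N := Finset.mem_range.2 (le_max_right m (k + 1))
  have hmN : (m : ℝ) ≤ N := by exact_mod_cast le_max_left m (k + 1)
  refine ⟨N, ?_⟩
  have hx' : inner ℂ (a k) x = 1 := hx
  have h1 : ∑ j ∈ Finset.range N, (1 / 2 : ℝ) ^ (j + 1) * truncLog N (1 - inner ℂ (a j) x)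
      ≤ ∑ j ∈ Finset.range N, ((1 / 2 : ℝ) ^ (j + 1) * T +
        if j = k then -((1 / 2 : ℝ) ^ (k + 1) * N) else 0) := by
    refine Finset.sum_le_sum fun j _ => ?_
    split_ifs with hjk
    · subst hjk
      have h0 : truncLog N (1 - inner ℂ (a j) x) = -N := by
        rw [hx', sub_self, truncLog, norm_zero, max_eq_right (Real.exp_pos _).le, Real.log_exp]
      rw [h0]
      have : 0 ≤ (1 / 2 : ℝ) ^ (j + 1) * T := by positivity
      linarith
    · rw [add_zero]
      exact mul_le_mul_of_nonneg_left (truncLog_one_sub_inner_le (ha j) x (by positivity))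
        (by positivity)
  rw [Finset.sum_add_distrib, ← Finset.sum_mul, Finset.sum_ite_eq' , if_pos hkN] at h1
  have h2 := mul_le_mul_of_nonneg_right (sum_half_pow_le_one N) hT0
  have h3 : (1 / 2 : ℝ) ^ N * T ≤ 1 * T :=
    mul_le_mul_of_nonneg_right (pow_le_one₀ (by norm_num) (by norm_num)) hT0
  have h4 : 3 * T ≤ (1 / 2 : ℝ) ^ (k + 1) * N := by
    have h5 : 2 ^ (k + 1) * (3 * T) ≤ N := hm.le.trans hmN
    calc 3 * T = (1 / 2 : ℝ) ^ (k + 1) * (2 ^ (k + 1) * (3 * T)) := by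
          rw [← mul_assoc, ← mul_pow]; norm_num
      _ ≤ _ := by gcongr
  unfold potential logPotential
  rw [← hT]
  linarith [sq_nonneg ‖x‖]

/-- Near the origin all the hyperplanes `⟨aₖ, x⟩ = 1` are far away, and the potentials are bounded
from below. -/
lemma neg_le_potential {a : ℕ → E} (ha : ∀ k, ‖a k‖ ≤ 1) {x : E} (hx : ‖x‖ < 1 / 2) (N : ℕ) :
    -202 ≤ potential a N x := by
  have h1 : ∀ k, -1 ≤ truncLog N (1 - inner ℂ (a k) x) := by
    intro k
    have h2 : ‖inner ℂ (a k) x‖ ≤ 1 / 2 := by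
      refine (norm_inner_le_norm _ _).trans ?_
      nlinarith [ha k, norm_nonneg x, norm_nonneg (a k)]
    have h3 : (1 / 2 : ℝ) ≤ ‖1 - inner ℂ (a k) x‖ := by
      have := norm_sub_norm_le (1 : ℂ) (inner ℂ (a k) x)
      rw [norm_one] at this
      linarith
    have h4 : Real.exp (-1) ≤ 1 / 2 := by
      have := Real.add_one_le_exp (1 : ℝ)
      rw [Real.exp_neg, inv_le_comm₀ (Real.exp_pos _) (by norm_num)]
      linarith
    unfold truncLog
    rw [Real.le_log_iff_exp_le (lt_max_of_lt_right (Real.exp_pos _))]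
    exact (h4.trans h3).trans (le_max_left _ _)
  have h2 : ∑ k ∈ Finset.range N, (1 / 2 : ℝ) ^ (k + 1) * (-1) ≤
      ∑ k ∈ Finset.range N, (1 / 2 : ℝ) ^ (k + 1) * truncLog N (1 - inner ℂ (a k) x) :=
    Finset.sum_le_sum fun k _ => mul_le_mul_of_nonneg_left (h1 k) (by positivity)
  rw [← Finset.sum_mul] at h2
  have h3 := sum_half_pow_le_one N
  have h4 : 0 ≤ (1 / 2 : ℝ) ^ N * (1 + ‖x‖ ^ 2) := by positivity
  unfold potential logPotential
  nlinarith [sq_nonneg ‖x‖]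

end

/-! ### The bounded strictly plurisubharmonic function -/

/-- The limit of the potentials, truncated from below at `-202`. The truncation keeps it bounded and
does not affect it on the ball of radius `1/2`, see `neg_le_potential`. -/
noncomputable def limitPotential {n : ℕ} (a : ℕ → EuclideanSpace ℂ (Fin n))
    (x : EuclideanSpace ℂ (Fin n)) : EReal :=
  ((⨅ N, max (potential a N x) (-202) : ℝ) : EReal)

section
variable {n : ℕ} {a : ℕ → EuclideanSpace ℂ (Fin n)}

lemma bddBelow_max_potential (a : ℕ → EuclideanSpace ℂ (Fin n)) (x : EuclideanSpace ℂ (Fin n)) :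
    BddBelow (range fun N => max (potential a N x) (-202)) :=
  ⟨-202, by rintro _ ⟨N, rfl⟩; exact le_max_right _ _⟩

lemma limitPotential_neg {x : EuclideanSpace ℂ (Fin n)} (hx : x ∈ sublevel a) :
    limitPotential a x < 0 := by
  obtain ⟨N, hN⟩ := hx
  refine EReal.coe_lt_coe_iff.2 ((ciInf_le (bddBelow_max_potential a x) N).trans_lt ?_)
  exact max_lt hN (by norm_num)

lemma limitPotential_mem (ha : ∀ k, ‖a k‖ ≤ 1) {U : Set (EuclideanSpace ℂ (Fin n))}
    (hU : U ⊆ sublevel a) : limitPotential a ∈ PSHLocBdd U := by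
  refine ⟨isPSHOn_iInf (B := -202)
    (fun N => ((continuous_potential a N).max continuous_const).continuousOn)
    (fun x _ => (antitone_potential ha x).sup antitone_const) (fun N x _ => le_max_right _ _)
    (fun N => submeanOn_of_locSubmean ((continuous_potential a N).max continuous_const)
      (fun F hF c => locSubmean_max_potential a N 202 hF c) U),
    fun z _ => ⟨univ, univ_mem, 202, fun w hw => ⟨?_, ?_⟩⟩⟩
  · exact EReal.coe_le_coe_iff.2 (le_ciInf fun N => le_max_right _ _)
  · refine (limitPotential_neg (hU hw.2)).le.trans ?_
    exact_mod_cast (by norm_num : (0 : ℝ) ≤ 202)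

lemma SubmeanOn.congr {E : Type*} [NormedAddCommGroup E] [NormedSpace ℂ E] {v w : E → ℝ}
    {U : Set E} (h : SubmeanOn v U) (heq : EqOn v w U) : SubmeanOn w U := by
  intro x ξ hd
  have hx : x ∈ U := by simpa using hd 0 (by simp)
  rw [← heq hx]
  refine (h x ξ hd).trans_eq (Real.circleAverage_congr_sphere fun ζ hζ => heq (hd ζ ?_))
  rw [abs_one, mem_sphere_zero_iff_norm] at hζ
  exact hζ.le

lemma isStrictPSHOn_limitPotential (ha : ∀ k, ‖a k‖ ≤ 1) :
    IsStrictPSHOn (limitPotential a) (Metric.ball 0 (1 / 2)) := by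
  refine ⟨fun z _ => EReal.coe_lt_top _, ⟨0, by simp, EReal.coe_ne_bot _⟩, fun θ hθ hc _ => ?_⟩
  obtain ⟨ε₀, hε₀, h⟩ := exists_submeanOn_normSq_add
    (hθ.of_le (WithTop.coe_le_coe.2 le_top)) hc
  obtain ⟨D, hD⟩ := hc.exists_bound_of_continuous hθ.continuous
  refine ⟨ε₀, hε₀, fun ε hε => ?_⟩
  have heq : (fun z => limitPotential a z + ((ε * θ z : ℝ) : EReal))
      = fun z => ((⨅ N, (max (potential a N z) (-202) + ε * θ z) : ℝ) : EReal) := by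
    ext z
    rw [limitPotential, ← EReal.coe_add, ciInf_add (bddBelow_max_potential a z)]
  have hcθ : Continuous fun z => ε * θ z := continuous_const.mul hθ.continuous
  rw [heq]
  refine isPSHOn_iInf (B := -202 - |ε| * D)
    (fun N => (((continuous_potential a N).max continuous_const).add hcθ).continuousOn)
    (fun x _ => ((antitone_potential ha x).sup antitone_const).add_const _)
    (fun N x _ => ?_) fun N => ?_
  · have h1 : |ε * θ x| ≤ |ε| * D := by
      rw [abs_mul]
      exact mul_le_mul_of_nonneg_left (hD x) (abs_nonneg _)
    have h2 := neg_abs_le (ε * θ x)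
    have h3 := le_max_right (potential a N x) (-202)
    linarith
  · have hcn : Continuous fun x : EuclideanSpace ℂ (Fin n) => ‖x‖ ^ 2 := by fun_prop
    refine (SubmeanOn.add (continuous_logPotential a N).continuousOn (hcn.add hcθ).continuousOn
      (submeanOn_of_locSubmean (continuous_logPotential a N)
        (fun F hF c => locSubmean_logPotential a N hF c) _) (h ε hε _)).congr fun x hx => ?_
    rw [mem_ball_zero_iff] at hx
    simp only [Pi.add_apply]
    rw [max_eq_left (neg_le_potential ha hx N), potential]
    ring

end

/-! ### Continuous plurisubharmonic functions on the domain -/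

section
variable {E : Type*} [NormedAddCommGroup E] [InnerProductSpace ℂ E]

lemma exists_inner_eq_one {a b : E} (ha : a ≠ 0) (hb : b ∉ Submodule.span ℂ {a}) :
    ∃ x : E, inner ℂ a x = 1 ∧ inner ℂ b x = 1 := by
  have haa : inner ℂ a a ≠ 0 := inner_self_ne_zero.2 ha
  set q : E := b - (inner ℂ a b / inner ℂ a a) • a with hq
  have hq0 : q ≠ 0 := fun h => hb <| by
    rw [sub_eq_zero.1 (hq.symm.trans h)]
    exact Submodule.smul_mem _ _ (Submodule.mem_span_singleton_self a)
  have haq : inner ℂ a q = 0 := by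
    rw [hq, inner_sub_right, inner_smul_right]
    field_simp
    simp
  have hbq : inner ℂ b q = inner ℂ q q := by
    have : b = q + (inner ℂ a b / inner ℂ a a) • a := by rw [hq]; abel
    conv_lhs => rw [this]
    rw [inner_add_left, inner_smul_left, haq, mul_zero, add_zero]
  have hqq : inner ℂ b q ≠ 0 := hbq ▸ inner_self_ne_zero.2 hq0
  set p : E := (inner ℂ a a)⁻¹ • a with hp
  have hap : inner ℂ a p = 1 := by rw [hp, inner_smul_right, inv_mul_cancel₀ haa]
  refine ⟨p + ((1 - inner ℂ b p) / inner ℂ b q) • q, ?_, ?_⟩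
  · rw [inner_add_right, inner_smul_right a q, haq, mul_zero, add_zero, hap]
  · rw [inner_add_right, inner_smul_right b q, div_mul_cancel₀ _ hqq, add_sub_cancel]

lemma SubmeanOn.locSubmean_line {g : E → ℝ} {Ω : Set E} (hg : SubmeanOn g Ω) {x v : E}
    (hv : ∀ ζ : ℂ, x + ζ • v ∈ Ω) (c : ℂ) : LocSubmean (fun ζ => g (x + ζ • v)) c := by
  refine Eventually.of_forall fun r => ?_
  have h := hg (x + c • v) ((r : ℂ) • v) fun ζ _ => by
    have := hv (c + ζ * r)
    rwa [add_smul, mul_smul, ← add_assoc] at this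
  rw [Real.circleAverage_eq_circleAverage_zero_one]
  refine h.trans_eq (congrArg (fun f => Real.circleAverage f 0 1) ?_)
  ext ζ
  congr 1
  rw [add_smul, smul_smul, mul_comm ζ (r : ℂ)]
  abel

/-- Liouville's theorem on an affine hyperplane. -/
lemma SubmeanOn.eq_on_hyperplane {g : E → ℝ} {Ω : Set E} (hg : SubmeanOn g Ω)
    (hc : ContinuousOn g Ω) (hneg : ∀ x ∈ Ω, g x < 0) {a : E}
    (hsub : {x | inner ℂ a x = 1} ⊆ Ω) {x y : E} (hx : inner ℂ a x = 1) (hy : inner ℂ a y = 1) :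
    g x = g y := by
  have hv : ∀ ζ : ℂ, x + ζ • (y - x) ∈ Ω := fun ζ => hsub <| by
    change inner ℂ a _ = 1
    rw [inner_add_right, inner_smul_right, inner_sub_right, hx, hy]
    ring
  have := LocSubmean.eq_of_nonpos (f := fun ζ : ℂ => g (x + ζ • (y - x)))
    (hc.comp_continuous (by fun_prop) hv) (hg.locSubmean_line hv) (fun ζ => (hneg _ (hv ζ)).le) 0 1
  simpa using this

/-- The component of the origin in the sublevel set. -/
def domain (a : ℕ → E) : Set E := connectedComponentIn (sublevel a) 0

lemma zero_mem_domain (a : ℕ → E) : (0 : E) ∈ domain a :=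
  mem_connectedComponentIn (ball_subset_sublevel a (by simp))

lemma domain_subset (a : ℕ → E) : domain a ⊆ sublevel a := connectedComponentIn_subset _ _

lemma ball_subset_domain (a : ℕ → E) : Metric.ball 0 10 ⊆ domain a := by
  let _ := NormedSpace.restrictScalars ℝ ℂ E
  exact ((convex_ball (0 : E) 10).isPreconnected).subset_connectedComponentIn (by simp)
    (ball_subset_sublevel a)

lemma hyperplane_subset_domain {a : ℕ → E} (ha : ∀ k, ‖a k‖ ≤ 1) {k : ℕ} (hk : 1 / 10 < ‖a k‖) :
    {x | inner ℂ (a k) x = 1} ⊆ domain a := by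
  let _ := NormedSpace.restrictScalars ℝ ℂ E
  have hk0 : (0 : ℝ) < ‖a k‖ := by linarith
  have hkk : inner ℂ (a k) (a k) ≠ 0 := inner_self_ne_zero.2 (norm_pos_iff.1 hk0)
  have hconv : Convex ℝ {x | inner ℂ (a k) x = 1} := by
    intro x hx y hy s t _ _ hst
    change inner ℂ (a k) _ = 1
    have hx' : inner ℂ (a k) x = 1 := hx
    have hy' : inner ℂ (a k) y = 1 := hy
    change inner ℂ (a k) ((s : ℂ) • x + (t : ℂ) • y) = 1
    rw [inner_add_right, inner_smul_right, inner_smul_right, hx', hy']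
    simp only [mul_one]
    exact_mod_cast hst
  refine subset_connectedComponentIn_of_mem hconv.isPreconnected
    (hyperplane_subset_sublevel ha k) (y := (inner ℂ (a k) (a k))⁻¹ • a k) ?_
    (ball_subset_domain a ?_)
  · change inner ℂ (a k) _ = 1
    rw [inner_smul_right, inv_mul_cancel₀ hkk]
  · rw [mem_ball_zero_iff, norm_smul, norm_inv, inner_self_eq_norm_sq_to_K]
    rw [norm_pow, RCLike.norm_ofReal, abs_of_pos hk0]
    rw [inv_mul_eq_div, sq, div_mul_cancel_left₀ hk0.ne', inv_lt_comm₀ hk0 (by norm_num)]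
    linarith

/-- Any two of the hyperplanes `⟨aₖ, x⟩ = 1` either meet or are both met by a third one. Hence a
continuous negative plurisubharmonic function takes the same value on all of them. -/
lemma exists_eq_on_hyperplanes [FiniteDimensional ℂ E] (hdim : 2 ≤ Module.finrank ℂ E) {a : ℕ → E}
    (ha : ∀ k, 1 / 10 < ‖a k‖ ∧ ‖a k‖ ≤ 1)
    (hdense : ∀ b : E, 1 / 10 < ‖b‖ → ‖b‖ < 1 → ∀ ε > 0, ∃ k, ‖a k - b‖ < ε)
    {g : E → ℝ} (hg : SubmeanOn g (domain a)) (hc : ContinuousOn g (domain a))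
    (hneg : ∀ x ∈ domain a, g x < 0) : ∃ c, ∀ k x, inner ℂ (a k) x = 1 → g x = c := by
  have hne : ∀ k, a k ≠ 0 := fun k h => by
    have := (ha k).1
    rw [h, norm_zero] at this
    norm_num at this
  have hH : ∀ k, {x | inner ℂ (a k) x = 1} ⊆ domain a := fun k =>
    hyperplane_subset_domain (fun k => (ha k).2) (ha k).1
  have hmeet : ∀ k l, a l ∉ Submodule.span ℂ {a k} →
      ∀ x y, inner ℂ (a k) x = 1 → inner ℂ (a l) y = 1 → g x = g y := by
    intro k l hl x y hx hy
    obtain ⟨p, hp1, hp2⟩ := exists_inner_eq_one (hne k) hl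
    exact (hg.eq_on_hyperplane hc hneg (hH k) hx hp1).trans
      (hg.eq_on_hyperplane hc hneg (hH l) hp2 hy)
  obtain ⟨m, hm⟩ : ∃ m, a m ∉ Submodule.span ℂ {a 0} := by
    obtain ⟨v, hv⟩ : ∃ v, v ∉ Submodule.span ℂ {a 0} := by
      by_contra! hall
      have h1 : Submodule.span ℂ {a 0} = ⊤ := Submodule.eq_top_iff'.2 hall
      have h2 := finrank_span_singleton (K := ℂ) (hne 0)
      rw [h1, finrank_top] at h2
      omega
    have hv0 : ‖v‖ ≠ 0 := fun h => hv (by rw [norm_eq_zero.1 h]; exact Submodule.zero_mem _)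
    set w : E := ((1 / 2 : ℂ) * (‖v‖ : ℂ)⁻¹) • v with hw
    have hwn : ‖w‖ = 1 / 2 := by
      rw [hw, norm_smul, norm_mul, norm_inv, Complex.norm_real, norm_norm, mul_assoc,
        inv_mul_cancel₀ hv0]
      norm_num
    have hws : w ∉ Submodule.span ℂ {a 0} := by
      rw [hw, Submodule.smul_mem_iff]
      · exact hv
      · simpa using hv0
    have hopen : IsOpen ((Submodule.span ℂ {a 0} : Set E)ᶜ) :=
      (Submodule.closed_of_finiteDimensional _).isOpen_compl
    obtain ⟨ε, hε, hball⟩ := Metric.isOpen_iff.1 hopen w hws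
    obtain ⟨m, hm⟩ := hdense w (by rw [hwn]; norm_num) (by rw [hwn]; norm_num) ε hε
    exact ⟨m, hball (by rwa [Metric.mem_ball, dist_eq_norm])⟩
  have hex : ∀ k, ∃ x, inner ℂ (a k) x = 1 := fun k =>
    ⟨(inner ℂ (a k) (a k))⁻¹ • a k, by
      rw [inner_smul_right, inv_mul_cancel₀ (inner_self_ne_zero.2 (hne k))]⟩
  obtain ⟨x₀, hx₀⟩ := hex 0
  refine ⟨g x₀, fun k x hx => ?_⟩
  by_cases hk : a k ∈ Submodule.span ℂ {a 0}
  · obtain ⟨y, hy⟩ := hex m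
    have hmk : a m ∉ Submodule.span ℂ {a k} := fun h =>
      hm (Submodule.span_le.2 (singleton_subset_iff.2 hk) h)
    exact (hmeet k m hmk x y hx hy).trans (hmeet 0 m hm x₀ y hx₀ hy).symm
  · exact (hmeet 0 k hk x₀ x hx₀ hx).symm

/-- The hyperplanes are dense outside of the closed unit ball, so `g` is constant there; by the
maximum principle on discs it is also constant near the origin. -/
lemma eq_const_on_ball {a : ℕ → E} (hΩ : IsOpen (domain a)) {e : E} (he : ‖e‖ = 1)
    (hdense : ∀ b : E, 1 / 10 < ‖b‖ → ‖b‖ < 1 → ∀ ε > 0, ∃ k, ‖a k - b‖ < ε)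
    {g : E → ℝ} (hg : SubmeanOn g (domain a)) (hc : ContinuousOn g (domain a)) {c : ℝ}
    (hplane : ∀ k x, inner ℂ (a k) x = 1 → g x = c) : ∀ x, ‖x‖ < 1 / 2 → g x = c := by
  have hshell : ∀ x, 1 < ‖x‖ → ‖x‖ < 10 → g x = c := by
    intro x hx1 hx10
    by_contra hcon
    have hx0 : (0 : ℝ) < ‖x‖ := by linarith
    have hxΩ : x ∈ domain a := ball_subset_domain a (by simpa using hx10)
    set b : E := ((‖x‖ : ℂ) ^ 2)⁻¹ • x with hb
    have hbn : ‖b‖ = ‖x‖⁻¹ := by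
      rw [hb, norm_smul, norm_inv, norm_pow, Complex.norm_real, norm_norm, inv_mul_eq_div, sq,
        div_mul_cancel_left₀ hx0.ne']
    have hbx : inner ℂ b x = 1 := by
      have h0 : (‖x‖ : ℂ) ≠ 0 := by exact_mod_cast hx0.ne'
      rw [hb, inner_smul_left, inner_self_eq_norm_sq_to_K]
      simp [h0]
    -- `Φ d` is the point of the hyperplane `⟨d, ·⟩ = 1` on the complex line through `x`
    let Φ : E → E := fun d => (inner ℂ d x)⁻¹ • x
    have hΦb : Φ b = x := by simp [Φ, hbx]
    have hin : Continuous fun d : E => inner ℂ d x := continuous_id.inner continuous_const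
    have hΦ : ContinuousAt Φ b :=
      (hin.continuousAt.inv₀ (by rw [hbx]; exact one_ne_zero)).smul continuousAt_const
    have hgΦ : ContinuousAt (fun d => g (Φ d)) b := by
      refine ContinuousAt.comp (f := Φ) (g := g) ?_ hΦ
      rw [hΦb]
      exact hc.continuousAt (hΩ.mem_nhds hxΩ)
    have hev1 : ∀ᶠ d in 𝓝 b, g (Φ d) ≠ c := hgΦ.eventually_ne (by rwa [hΦb])
    have hev2 : ∀ᶠ d in 𝓝 b, inner ℂ d x ≠ 0 :=
      hin.continuousAt.eventually_ne (by rw [hbx]; exact one_ne_zero)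
    obtain ⟨ε, hε, hball⟩ := Metric.eventually_nhds_iff.1 (hev1.and hev2)
    obtain ⟨k, hk⟩ := hdense b
      (by rw [hbn, lt_inv_comm₀ (by norm_num) hx0]; linarith)
      (by rw [hbn]; exact inv_lt_one_of_one_lt₀ hx1) ε hε
    obtain ⟨h1, h2⟩ := hball (y := a k) (by rwa [dist_eq_norm])
    exact h1 (hplane k _ (by rw [inner_smul_right, inv_mul_cancel₀ h2]))
  have hnorm : ∀ (ζ : ℂ), ‖ζ • e‖ = ‖ζ‖ := fun ζ => by rw [norm_smul, he, mul_one]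
  have hdisc : ∀ (x : E) (r : ℝ), 0 ≤ r → ‖x‖ + r < 10 →
      (∀ ζ : ℂ, ‖ζ‖ ≤ 1 → x + ζ • ((r : ℂ) • e) ∈ domain a) := by
    intro x r hr hxr ζ hζ
    refine ball_subset_domain a (mem_ball_zero_iff.2 ((norm_add_le _ _).trans_lt ?_))
    rw [smul_smul, hnorm, norm_mul, Complex.norm_real, Real.norm_eq_abs, abs_of_nonneg hr]
    nlinarith
  have hle : ∀ x, ‖x‖ < 7 → g x ≤ c := by
    intro x hx
    by_cases hx1 : 1 < ‖x‖
    · exact (hshell x hx1 (by linarith)).le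
    push Not at hx1
    have hd := hdisc x 3 (by norm_num) (by linarith)
    refine (hg x _ hd).trans (Real.circleAverage_mono_on_of_le_circle
      ((continuousOn_disc hc hd).circleIntegrable zero_le_one) fun ζ hζ => ?_)
    rw [abs_one, mem_sphere_zero_iff_norm] at hζ
    have h3 : ‖ζ • (((3 : ℝ) : ℂ) • e)‖ = 3 := by
      rw [smul_smul, hnorm, norm_mul, hζ, Complex.norm_real]; norm_num
    have h4 := norm_add_le x (ζ • (((3 : ℝ) : ℂ) • e))
    have h5 := norm_sub_le (x + ζ • (((3 : ℝ) : ℂ) • e)) x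
    rw [add_sub_cancel_left] at h5
    exact (hshell _ (by linarith) (by linarith)).le
  intro x hx
  set y : E := x + (3 : ℂ) • e with hy
  have he3 : ‖(3 : ℂ) • e‖ = 3 := by rw [hnorm]; norm_num
  have hy1 : ‖y‖ ≤ ‖x‖ + 3 := (norm_add_le _ _).trans (by rw [he3])
  have hy2 : 3 ≤ ‖y‖ + ‖x‖ := by
    have := norm_sub_le y x
    rwa [hy, add_sub_cancel_left, he3] at this
  have hyc : g y = c := hshell y (by linarith) (by linarith)
  have hd := hdisc y 3 (by norm_num) (by linarith)
  have hx_eq : y + (-1 : ℂ) • (((3 : ℝ) : ℂ) • e) = x := by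
    rw [hy]; push_cast; simp
  have := eq_of_le_circleAverage zero_le_one (continuousOn_disc hc hd) (M := c) (fun ζ hζ => ?_)
    (hyc ▸ hg y _ hd) (-1) (by simp)
  · simpa only [hx_eq] using this
  · rw [mem_sphere_zero_iff_norm] at hζ
    refine hle _ ((norm_add_le _ _).trans_lt ?_)
    have h3 : ‖ζ • (((3 : ℝ) : ℂ) • e)‖ = 3 := by
      rw [smul_smul, hnorm, norm_mul, hζ, Complex.norm_real]; norm_num
    linarith

end

/-! ### Cores -/

/-- A function that is constant near a point is not strictly plurisubharmonic there: adding a small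
multiple of a bump function violates the sub-mean value inequality. -/
lemma not_isStrictPSHNear_of_eq_const {n : ℕ} {f : EuclideanSpace ℂ (Fin n) → EReal}
    {Ω ω : Set (EuclideanSpace ℂ (Fin n))} {z e : EuclideanSpace ℂ (Fin n)} (he : ‖e‖ = 1)
    (hω : IsOpen ω) (hz : z ∈ ω) {c : ℝ} (hf : ∀ x ∈ ω, f x = c) : ¬ IsStrictPSHNear f Ω z := by
  rintro ⟨U, hU, hzU, -, -, -, hstrict⟩
  obtain ⟨ρ, hρ, hball⟩ := Metric.isOpen_iff.1 (hU.inter hω) z ⟨hzU, hz⟩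
  let θ : ContDiffBump z := ⟨ρ / 8, ρ / 4, by positivity, by linarith⟩
  obtain ⟨ε₀, hε₀, h⟩ := hstrict θ θ.contDiff θ.hasCompactSupport (by
    rw [θ.tsupport_eq]
    exact (Metric.closedBall_subset_ball (by change ρ / 4 < ρ; linarith)).trans
      (hball.trans inter_subset_left))
  have hpsh := h (ε₀ / 2) ⟨by linarith, by linarith⟩
  set ξ : EuclideanSpace ℂ (Fin n) := ((ρ / 2 : ℝ) : ℂ) • e with hξ
  have hξn : ∀ ζ : ℂ, ‖ζ • ξ‖ = ‖ζ‖ * (ρ / 2) := fun ζ => by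
    rw [hξ, norm_smul, norm_smul, he, mul_one, Complex.norm_real, Real.norm_eq_abs,
      abs_of_pos (by positivity)]
  have hmem : ∀ ζ : ℂ, ‖ζ‖ ≤ 1 → z + ζ • ξ ∈ U ∩ ω := fun ζ hζ => hball <| by
    rw [Metric.mem_ball, dist_eq_norm, add_sub_cancel_left, hξn]
    nlinarith
  have hmean := hpsh.le_circleMean z ξ fun ζ hζ => (hmem ζ hζ).1
  rw [circleMean_eq (f := fun _ => c) (circleIntegrable_const _ _ _), Real.circleAverage_const,
    hf z hz, θ.one_of_mem_closedBall (Metric.mem_closedBall_self θ.rIn_pos.le), ← EReal.coe_add,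
    EReal.coe_le_coe_iff] at hmean
  · linarith
  · intro ζ hζ
    rw [mem_sphere_zero_iff_norm] at hζ
    rw [hf _ (hmem ζ hζ.le).2, θ.zero_of_le_dist, mul_zero]
    · simp
    · rw [dist_eq_norm, add_sub_cancel_left, hξn, hζ]
      change ρ / 4 ≤ 1 * (ρ / 2)
      linarith

lemma IsPSHOn.submeanOn_sub_const {n : ℕ} {g : EuclideanSpace ℂ (Fin n) → ℝ}
    {f : EuclideanSpace ℂ (Fin n) → EReal} {Ω : Set (EuclideanSpace ℂ (Fin n))}
    (hc : ContinuousOn g Ω) (hfg : ∀ x ∈ Ω, f x = g x) (h : IsPSHOn f Ω) (M : ℝ) :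
    SubmeanOn (fun x => g x + -M) Ω :=
  (h.submeanOn hc hfg).add hc continuousOn_const fun x ξ _ => by rw [Real.circleAverage_const]

end PSHCore

theorem theorem1 (n : ℕ) (hn : 2 ≤ n) :
    ∃ Ω ω : Set (EuclideanSpace ℂ (Fin n)),
      PSHCore.IsPseudoconvexDomain Ω ∧ IsOpen ω ∧ ω.Nonempty ∧ ω ⊆ Ω ∧
      (∃ φ ∈ PSHCore.PSHLocBdd Ω, (∀ z ∈ Ω, φ z < 0) ∧ PSHCore.IsStrictPSHOn φ ω) ∧
      (∀ ψ ∈ PSHCore.PSHCont Ω, (∀ z ∈ Ω, ψ z < 0) → ∃ c : ℝ, ∀ z ∈ ω, ψ z = (c : EReal)) ∧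
      PSHCore.coreLocBdd Ω ≠ PSHCore.coreCont Ω := by
  set e : EuclideanSpace ℂ (Fin n) := EuclideanSpace.single ⟨0, by omega⟩ 1 with he_def
  have he : ‖e‖ = 1 := by simp [he_def]
  -- the normals of the hyperplanes form a dense sequence in the shell `1 / 10 < ‖b‖ < 1`
  let S : Set (EuclideanSpace ℂ (Fin n)) := {b | 1 / 10 < ‖b‖ ∧ ‖b‖ < 1}
  have hS : Nonempty S := ⟨⟨(1 / 2 : ℂ) • e, by
    change 1 / 10 < ‖(1 / 2 : ℂ) • e‖ ∧ ‖(1 / 2 : ℂ) • e‖ < 1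
    rw [norm_smul, he]; norm_num⟩⟩
  let a : ℕ → EuclideanSpace ℂ (Fin n) := fun k => TopologicalSpace.denseSeq S k
  have ha : ∀ k, 1 / 10 < ‖a k‖ ∧ ‖a k‖ ≤ 1 := fun k =>
    ⟨(TopologicalSpace.denseSeq S k).2.1, (TopologicalSpace.denseSeq S k).2.2.le⟩
  have ha' : ∀ k, ‖a k‖ ≤ 1 := fun k => (ha k).2
  have hdense : ∀ b : EuclideanSpace ℂ (Fin n), 1 / 10 < ‖b‖ → ‖b‖ < 1 →
      ∀ ε > 0, ∃ k, ‖a k - b‖ < ε := fun b h1 h2 ε hε => by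
    obtain ⟨k, hk⟩ := (TopologicalSpace.denseRange_denseSeq S).exists_dist_lt ⟨b, h1, h2⟩ hε
    exact ⟨k, by rw [← dist_eq_norm, dist_comm]; exact hk⟩
  have hopen : IsOpen (PSHCore.domain a) := (PSHCore.isOpen_sublevel a).connectedComponentIn
  have hconst : ∀ g : EuclideanSpace ℂ (Fin n) → ℝ, ContinuousOn g (PSHCore.domain a) →
      PSHCore.SubmeanOn g (PSHCore.domain a) → (∀ x ∈ PSHCore.domain a, g x < 0) →
      ∃ c, ∀ x ∈ Metric.ball (0 : EuclideanSpace ℂ (Fin n)) (1 / 2), g x = c := by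
    intro g hc hg hneg
    obtain ⟨c, hplane⟩ := PSHCore.exists_eq_on_hyperplanes
      (by rwa [finrank_euclideanSpace_fin]) ha hdense hg hc hneg
    exact ⟨c, fun x hx => PSHCore.eq_const_on_ball hopen he hdense hg hc hplane x
      (mem_ball_zero_iff.1 hx)⟩
  have hsub : Metric.ball (0 : EuclideanSpace ℂ (Fin n)) (1 / 2) ⊆ PSHCore.domain a :=
    (Metric.ball_subset_ball (by norm_num)).trans (PSHCore.ball_subset_domain a)
  have hmem := PSHCore.limitPotential_mem ha' (PSHCore.domain_subset a)
  have hneg : ∀ z ∈ PSHCore.domain a, PSHCore.limitPotential a z < 0 := fun z hz =>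
    PSHCore.limitPotential_neg (PSHCore.domain_subset a hz)
  refine ⟨PSHCore.domain a, Metric.ball 0 (1 / 2),
    (PSHCore.discConvex_sublevel ha').isPseudoconvexDomain (PSHCore.isOpen_sublevel a)
      (PSHCore.ball_subset_sublevel a (by simp)), Metric.isOpen_ball, ⟨0, by simp⟩, hsub,
    ⟨_, hmem, hneg, PSHCore.isStrictPSHOn_limitPotential ha'⟩, ?_, ?_⟩
  · rintro ψ ⟨hψ, g, hc, hψg⟩ hψneg
    obtain ⟨c, hgc⟩ := hconst g hc (hψ.submeanOn hc hψg) fun x hx => by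
      have := hψneg x hx
      rw [hψg x hx] at this
      exact_mod_cast this
    exact ⟨c, fun z hz => by rw [hψg z (hsub hz), hgc z hz]⟩
  · -- the origin belongs to the second core but not to the first one
    intro heq
    have h0 : (0 : EuclideanSpace ℂ (Fin n)) ∈ PSHCore.coreCont (PSHCore.domain a) := by
      refine ⟨PSHCore.zero_mem_domain a, ?_⟩
      rintro f ⟨hf, g, hc, hfg⟩ ⟨M, hM⟩
      obtain ⟨c, hgc⟩ := hconst (fun x => g x + -(M + 1)) (hc.add continuousOn_const)
        (hf.submeanOn_sub_const hc hfg _) fun x hx => by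
          have := hM x hx
          rw [hfg x hx, EReal.coe_le_coe_iff] at this
          linarith
      refine PSHCore.not_isStrictPSHNear_of_eq_const he Metric.isOpen_ball
        (Metric.mem_ball_self (by norm_num : (0 : ℝ) < 1 / 2)) (c := c + (M + 1)) fun x hx => ?_
      rw [hfg x (hsub hx), ← hgc x hx]
      congr 1
      ring
    rw [← heq] at h0
    refine h0.2 _ hmem ⟨0, fun w hw => ?_⟩ ⟨Metric.ball 0 (1 / 2), Metric.isOpen_ball, by simp,
      hsub, PSHCore.isStrictPSHOn_limitPotential ha'⟩
    simpa using (hneg w hw).le
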